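/- Let $K$ be a field and let $\mathcal{G}=(G^0,\mathcal{G}^1,r,s)$ be an ultragraph with $G^0\neq\varnothing$; that is, $G^0$ (vertices) and $\mathcal{G}^1$ (edges) are countable sets, $s:\mathcal{G}^1\to G^0$ and $r:\mathcal{G}^1\to\mathcal{P}(G^0)\setminus\{\varnothing\}$ are functions. Let $\mathcal{G}^0\subseteq\mathcal{P}(G^0)$ be the smallest family that contains $\varnothing$, all singletons $\{v\}$ $(v\in G^0)$ and all $r(e)$ $(e\in\mathcal{G}^1)$ and is closed under relative complements, finite unions and finite intersections. The Leavitt path algebra $L_K(\mathcal{G})$ is the (not necessarily unital) associative $K$-algebra generated by $\{p_A\mid A\in\mathcal{G}^0\}\cup\{s_e,s_e^*\mid e\in\mathcal{G}^1\}$ subject to the following relations, for all $A,B\in\mathcal{G}^0$ and $e,f\in\mathcal{G}^1$, where $p_v:=p_{\{v\}}$: 1. $p_\varnothing=0$, $p_Ap_B=p_{A\cap B}$, $p_{A\cup B}=p_A+p_B-p_{A\cap B}$; 2. $p_{s(e)}s_e=s_e=s_ep_{r(e)}$ and $p_{r(e)}s_e^*=s_e^*=s_e^*p_{s(e)}$;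 3. $s_e^*s_f=\delta_{e,f}\,p_{r(e)}$; 4. $p_v=\sum_{s(e)=v}s_es_e^*$ for every $v\in G^0$ with $0<|s^{-1}(v)|<\infty$. A path of length $n\ge 1$ is a sequence $\alpha_1\cdots\alpha_n$ of edges with $s(\alpha_{i+1})\in r(\alpha_i)$ for $1\le i<n$; its source is $s(\alpha_1)$ and its range is $r(\alpha_n)$. For $v,w\in G^0$ write $v\ge w$ if $v=w$ or there is a path of length $\geq 1$ with source $v$ whose range contains $w$. The ultragraph $\mathcal{G}$ is downward directed if for all $v,w\in G^0$ there is $u\in G^0$ with $v\ge u$ and $w\ge u$. A cycle is a path $\alpha=\alpha_1\cdots\alpha_n$ with $n\ge1$, $s(\alpha_1)\in r(\alpha_n)$ and $s(\alpha_i)\ne s(\alpha_j)$ for $i\ne j$. An exit for $\alpha$ is either an edge $e$ such that, for some $i$, $s(e)\in r(\alpha_i)$ and $e\ne\alpha_{i+1}$ (where $\alpha_{n+1}:=\alpha_1$), or a vertex $w$ with $s^{-1}(w)=\varnothing$ and $w\in r(\alpha_i)$ for some $i$. A (not necessarily unital) ring $R$ is primitive if it has a faithful simple left module, where a left $R$-module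 $M$ is simple if $RM\neq0$ and its only submodules are $0$ and $M$. Then $L_K(\mathcal{G})$ is a primitive ring if and only if (1) $\mathcal{G}$ is downward directed, and (2) every cycle in $\mathcal{G}$ has an exit. -/

import Mathlib

universe u

/-- An ultragraph with vertex set `V` and edge set `E`: every edge has a source vertex and a
nonempty set of vertices as its range. (Countability of `V` and `E` is imposed separately.) -/
structure Ultragraph (V E : Type*) where
  source : E → V
  range : E → Set V
  range_nonempty : ∀ e, (range e).Nonempty

namespace Ultragraph

variable {V E : Type*} (G : Ultragraph V E)

/-- The generalized vertices: the smallest family of subsets of `V` that contains the singletons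
and the ranges of edges and is closed under relative complements, finite unions (the empty one
included) and finite intersections. -/
inductive IsGenVertex : Set V → Prop
  | empty : IsGenVertex ∅
  | singleton (v : V) : IsGenVertex {v}
  | range (e : E) : IsGenVertex (G.range e)
  | union {A B : Set V} : IsGenVertex A → IsGenVertex B → IsGenVertex (A ∪ B)
  | inter {A B : Set V} : IsGenVertex A → IsGenVertex B → IsGenVertex (A ∩ B)
  | diff {A B : Set V} : IsGenVertex A → IsGenVertex B → IsGenVertex (A \ B)

/-- The type of generalized vertices. -/
def GenVertex : Type _ := {A : Set V // G.IsGenVertex A}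

/-- A vertex is a sink if it emits no edge. -/
def IsSink (v : V) : Prop := ∀ e, G.source e ≠ v

/-- A list of edges is a path (of positive length) if it is nonempty and the source of each edge
after the first lies in the range of the preceding one. -/
def IsPath (α : List E) : Prop :=
  α ≠ [] ∧ α.IsChain (fun e f => G.source f ∈ G.range e)

/-- `v ≥ w`: there is a finite path with source `v` whose range contains `w`. The paths of length
zero contribute the case `v = w`. -/
def Reaches (v w : V) : Prop :=
  v = w ∨ ∃ (α : List E) (h : α ≠ []), G.IsPath α ∧
    G.source (α.head h) = v ∧ w ∈ G.range (α.getLast h)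

/-- Any two vertices have a common vertex below them. -/
def DownwardDirected : Prop := ∀ v w : V, ∃ x : V, G.Reaches v x ∧ G.Reaches w x

/-- A cycle: a path of positive length that returns to its source, and whose edges have pairwise
distinct sources. -/
def IsCycle (α : List E) : Prop :=
  G.IsPath α ∧ (∃ h : α ≠ [], G.source (α.head h) ∈ G.range (α.getLast h)) ∧
    (α.map G.source).Nodup

/-- An exit for the cycle `α`: an edge `e` with source in the range of some `α i` that is not the
next edge of the cycle (indices are read cyclically), or a sink in the range of some `α i`. -/
def HasExit (α : List E) : Prop :=
  (∃ (e : E) (i : Fin α.length), G.source e ∈ G.range (α.get i) ∧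
      e ≠ α.get ⟨(i + 1) % α.length, Nat.mod_lt _ i.pos⟩) ∨
    ∃ (w : V) (i : Fin α.length), G.IsSink w ∧ w ∈ G.range (α.get i)

/-- Symbols for the generators `p_A`, `s_e`, `s_e^*` of the Leavitt path algebra. -/
inductive Gen
  | vert (A : G.GenVertex) : Gen
  | edge (e : E) : Gen
  | ghost (e : E) : Gen

section Algebra

variable (K : Type*) [Field K]

/-- The free associative (not necessarily unital) `K`-algebra on the symbols: the semigroup
algebra of the free semigroup, i.e. noncommutative polynomials without constant term. -/
abbrev FreeAlg : Type _ := MonoidAlgebra K (FreeSemigroup G.Gen)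

/-- A symbol as an element of the free algebra. -/
noncomputable def gen (x : G.Gen) : G.FreeAlg K := MonoidAlgebra.single (FreeSemigroup.of x) 1

/-- The symbol `p_A`. -/
noncomputable def P (A : Set V) (hA : G.IsGenVertex A) : G.FreeAlg K := G.gen K (.vert ⟨A, hA⟩)

/-- The symbol `s_e`. -/
noncomputable def S (e : E) : G.FreeAlg K := G.gen K (.edge e)

/-- The symbol `s_e^*`. -/
noncomputable def Sstar (e : E) : G.FreeAlg K := G.gen K (.ghost e)

/-- The defining relations of the Leavitt path algebra of an ultragraph. -/
inductive Rel : G.FreeAlg K → G.FreeAlg K → Prop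
  | p_empty : Rel (G.P K ∅ .empty) 0
  | p_inter {A B : Set V} (hA : G.IsGenVertex A) (hB : G.IsGenVertex B) :
      Rel (G.P K A hA * G.P K B hB) (G.P K (A ∩ B) (hA.inter hB))
  | p_union {A B : Set V} (hA : G.IsGenVertex A) (hB : G.IsGenVertex B) :
      Rel (G.P K (A ∪ B) (hA.union hB)) (G.P K A hA + G.P K B hB - G.P K (A ∩ B) (hA.inter hB))
  | source_s (e : E) : Rel (G.P K {G.source e} (.singleton _) * G.S K e) (G.S K e)
  | s_range (e : E) : Rel (G.S K e * G.P K (G.range e) (.range e)) (G.S K e)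
  | range_sstar (e : E) : Rel (G.P K (G.range e) (.range e) * G.Sstar K e) (G.Sstar K e)
  | sstar_source (e : E) : Rel (G.Sstar K e * G.P K {G.source e} (.singleton _)) (G.Sstar K e)
  | sstar_s_self (e : E) : Rel (G.Sstar K e * G.S K e) (G.P K (G.range e) (.range e))
  | sstar_s_ne {e f : E} (h : e ≠ f) : Rel (G.Sstar K e * G.S K f) 0
  | regular (v : V) (hfin : {e | G.source e = v}.Finite) (hne : {e | G.source e = v}.Nonempty) :
      Rel (G.P K {v} (.singleton v)) (∑ e ∈ hfin.toFinset, G.S K e * G.Sstar K e)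

/-- The congruence that the relations generate. The free algebra has no unit, so compatibility
with scalars is not automatic: the scalar multiples of the relations are put in explicitly. -/
noncomputable def leavittCon : RingCon (G.FreeAlg K) :=
  ringConGen fun x y => ∃ (k : K) (a b : G.FreeAlg K), G.Rel K a b ∧ x = k • a ∧ y = k • b

/-- The Leavitt path algebra `L_K(G)`: the (not necessarily unital) associative `K`-algebra given
by the generators and relations above. -/
def LeavittPathAlgebra : Type _ := (G.leavittCon K).Quotient

noncomputable instance : NonUnitalRing (G.LeavittPathAlgebra K) :=
  inferInstanceAs (NonUnitalRing (G.leavittCon K).Quotient)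

theorem leavittCon_smul (k : K) {x y : G.FreeAlg K} (h : G.leavittCon K x y) :
    G.leavittCon K (k • x) (k • y) := by
  have h' : RingConGen.Rel
    (fun x y => ∃ (k : K) (a b : G.FreeAlg K), G.Rel K a b ∧ x = k • a ∧ y = k • b) x y := h
  clear h
  change RingConGen.Rel _ _ _
  induction h' generalizing k with
  | of x y h =>
    obtain ⟨l, a, b, hab, rfl, rfl⟩ := h
    exact .of _ _ ⟨k * l, a, b, hab, (mul_smul k l a).symm, (mul_smul k l b).symm⟩
  | refl x => exact .refl _
  | symm _ ih => exact .symm (ih k)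
  | trans _ _ ih₁ ih₂ => exact .trans (ih₁ k) (ih₂ k)
  | add _ _ ih₁ ih₂ => simpa only [smul_add] using RingConGen.Rel.add (ih₁ k) (ih₂ k)
  | mul _ h₂ ih₁ _ => simpa only [smul_mul_assoc] using RingConGen.Rel.mul (ih₁ k) h₂

noncomputable instance : Module K (G.LeavittPathAlgebra K) where
  smul k := Quotient.map' (k • ·) fun _ _ h => G.leavittCon_smul K k h
  one_smul := by rintro ⟨x⟩; exact congrArg (Quot.mk _) (one_smul K x)
  mul_smul k l := by rintro ⟨x⟩; exact congrArg (Quot.mk _) (mul_smul k l x)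
  smul_zero k := congrArg (Quot.mk _) (smul_zero k)
  smul_add k := by rintro ⟨x⟩ ⟨y⟩; exact congrArg (Quot.mk _) (smul_add k x y)
  add_smul k l := by rintro ⟨x⟩; exact congrArg (Quot.mk _) (add_smul k l x)
  zero_smul := by rintro ⟨x⟩; exact congrArg (Quot.mk _) (zero_smul K x)

instance : IsScalarTower K (G.LeavittPathAlgebra K) (G.LeavittPathAlgebra K) where
  smul_assoc k := by rintro ⟨x⟩ ⟨y⟩; exact congrArg (Quot.mk _) (smul_mul_assoc k x y)

instance : SMulCommClass K (G.LeavittPathAlgebra K) (G.LeavittPathAlgebra K) where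
  smul_comm k := by rintro ⟨x⟩ ⟨y⟩; exact congrArg (Quot.mk _) (mul_smul_comm k x y).symm

end Algebra

end Ultragraph

/-- A left action `ρ` of a not necessarily unital ring `R` on an abelian group `M` makes `M` a
simple left `R`-module: `R M ≠ 0`, and `0` and `M` are the only submodules. -/
def IsSimpleAction {R M : Type*} [NonUnitalRing R] [AddCommGroup M]
    (ρ : R →ₙ+* AddMonoid.End M) : Prop :=
  (∃ (r : R) (m : M), ρ r m ≠ 0) ∧
    ∀ N : AddSubgroup M, (∀ (r : R), ∀ m ∈ N, ρ r m ∈ N) → N = ⊥ ∨ N = ⊤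

/-- A not necessarily unital ring is (left) primitive if it has a faithful simple left module.
A simple module is a quotient of `R` by a left ideal, so the universe of `R` is large enough. -/
def IsPrimitiveRing (R : Type u) [NonUnitalRing R] : Prop :=
  ∃ (M : Type u) (_ : AddCommGroup M) (ρ : R →ₙ+* AddMonoid.End M),
    IsSimpleAction ρ ∧ Function.Injective ρ

/-! Sufficiency. Call a path a boundary path if it is infinite or ends in a sink, and fix one, `x`.
On the space whose basis consists of the boundary paths that share a tail with `x`, edges act by
being prepended and ghost edges by being removed. This module is simple for every `x`: projections
in the algebra separate basis vectors, and edges and ghost edges connect any two of them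
(`isSimpleAction_action`). In a downward directed ultragraph with countably many vertices, `x` can
be chosen so that every vertex reaches a vertex on it (`exists_forall_reaches`), and then every
vertex is the source of a basis path. If moreover all cycles have exits, no finite set of periods
serves all basis paths from a given vertex (`aperiodic_of_hasExit`), and this makes the action
faithful (`action_injective`), in the manner of the Cuntz-Krieger uniqueness theorem. Faithfulness
needs no basis of the algebra: multiplication by ghost edges lowers the number of leading edges,
which reduces the question to combinations of ghost words, and their coefficients are read off at
aperiodic points.

Necessity. Every nonzero vector of a simple module generates it. If `v` and `w` have no common
vertex below them, then `p_v L p_w = 0`, so `p_v` and `p_w` cannot both act nontrivially. If a cycle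
`c` at `v` has no exit, then the corner `p_v L p_v` is spanned by the powers of `c` and `c^*`, hence
commutative. A faithful simple module would make such a corner a field; but `p_v - c` is nonzero and
has no inverse there, as its action on boundary paths with a degree shows (`loop_mul_ne`). -/

namespace Ultragraph

variable {V E : Type*} (G : Ultragraph V E)

/-! ### Generators, relations and the universal property -/

namespace LeavittPathAlgebra

section Basic

variable (K : Type*) [Field K]

/-- The class of an element of the free algebra. -/
noncomputable def mk : G.FreeAlg K →ₙ+* G.LeavittPathAlgebra K where
  toFun x := ((x : (G.leavittCon K).Quotient) : G.LeavittPathAlgebra K)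
  map_zero' := rfl
  map_add' _ _ := rfl
  map_mul' _ _ := rfl

theorem mk_smul (k : K) (x : G.FreeAlg K) : mk G K (k • x) = k • mk G K x := rfl

theorem mk_surjective : Function.Surjective (mk G K) := Quotient.mk''_surjective

variable {G K} in
theorem mk_eq_of_rel {x y : G.FreeAlg K} (h : G.Rel K x y) : mk G K x = mk G K y :=
  Quotient.sound' <| RingConGen.Rel.of _ _ ⟨1, x, y, h, (one_smul _ _).symm, (one_smul _ _).symm⟩

open Classical in
/-- The generator `p_A`; it is `0` when `A` is not a generalized vertex. -/
noncomputable def p (A : Set V) : G.LeavittPathAlgebra K :=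
  if hA : G.IsGenVertex A then mk G K (G.P K A hA) else 0

/-- The generator `s_e`. -/
noncomputable def s (e : E) : G.LeavittPathAlgebra K := mk G K (G.S K e)

/-- The generator `s_e^*`. -/
noncomputable def t (e : E) : G.LeavittPathAlgebra K := mk G K (G.Sstar K e)

variable {G K}

theorem p_of {A : Set V} (hA : G.IsGenVertex A) : p G K A = mk G K (G.P K A hA) := dif_pos hA

@[simp] theorem p_empty : p G K ∅ = 0 := by
  rw [p_of .empty, mk_eq_of_rel .p_empty, map_zero]

theorem p_mul_p {A B : Set V} (hA : G.IsGenVertex A) (hB : G.IsGenVertex B) :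
    p G K A * p G K B = p G K (A ∩ B) := by
  rw [p_of hA, p_of hB, p_of (hA.inter hB), ← map_mul, mk_eq_of_rel (.p_inter hA hB)]

theorem p_union {A B : Set V} (hA : G.IsGenVertex A) (hB : G.IsGenVertex B) :
    p G K (A ∪ B) = p G K A + p G K B - p G K (A ∩ B) := by
  rw [p_of hA, p_of hB, p_of (hA.inter hB), p_of (hA.union hB), mk_eq_of_rel (.p_union hA hB),
    map_sub, map_add]

@[simp] theorem p_source_mul_s (e : E) : p G K {G.source e} * s G K e = s G K e := by
  rw [p_of (.singleton _), s, ← map_mul, mk_eq_of_rel (.source_s e)]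

@[simp] theorem s_mul_p_range (e : E) : s G K e * p G K (G.range e) = s G K e := by
  rw [p_of (.range _), s, ← map_mul, mk_eq_of_rel (.s_range e)]

@[simp] theorem p_range_mul_t (e : E) : p G K (G.range e) * t G K e = t G K e := by
  rw [p_of (.range _), t, ← map_mul, mk_eq_of_rel (.range_sstar e)]

@[simp] theorem t_mul_p_source (e : E) : t G K e * p G K {G.source e} = t G K e := by
  rw [p_of (.singleton _), t, ← map_mul, mk_eq_of_rel (.sstar_source e)]

@[simp] theorem t_mul_s (e : E) : t G K e * s G K e = p G K (G.range e) := by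
  rw [p_of (.range _), t, s, ← map_mul, mk_eq_of_rel (.sstar_s_self e)]

theorem t_mul_s_of_ne {e f : E} (h : e ≠ f) : t G K e * s G K f = 0 := by
  rw [t, s, ← map_mul, mk_eq_of_rel (.sstar_s_ne h), map_zero]

theorem p_regular (v : V) (hfin : {e | G.source e = v}.Finite)
    (hne : {e | G.source e = v}.Nonempty) :
    p G K {v} = ∑ e ∈ hfin.toFinset, s G K e * t G K e := by
  rw [p_of (.singleton _), mk_eq_of_rel (.regular v hfin hne), map_sum]
  simp only [s, t, map_mul]

theorem p_mul_self {A : Set V} (hA : G.IsGenVertex A) : p G K A * p G K A = p G K A := by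
  rw [p_mul_p hA hA, Set.inter_self]

theorem p_mul_p_singleton {A : Set V} (hA : G.IsGenVertex A) {v : V} (h : v ∈ A) :
    p G K A * p G K {v} = p G K {v} := by
  rw [p_mul_p hA (.singleton v), Set.inter_eq_right.2 (by simpa)]

theorem p_mul_p_singleton_of_notMem {A : Set V} (hA : G.IsGenVertex A) {v : V} (h : v ∉ A) :
    p G K A * p G K {v} = 0 := by
  rw [p_mul_p hA (.singleton v), Set.inter_singleton_eq_empty.2 h, p_empty]

theorem p_singleton_mul_p {A : Set V} (hA : G.IsGenVertex A) {v : V} (h : v ∈ A) :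
    p G K {v} * p G K A = p G K {v} := by
  rw [p_mul_p (.singleton v) hA, Set.inter_eq_left.2 (by simpa)]

theorem p_singleton_mul_p_of_notMem {A : Set V} (hA : G.IsGenVertex A) {v : V} (h : v ∉ A) :
    p G K {v} * p G K A = 0 := by
  rw [p_mul_p (.singleton v) hA, Set.singleton_inter_eq_empty.2 h, p_empty]

theorem p_mul_s {A : Set V} (hA : G.IsGenVertex A) {e : E} (h : G.source e ∈ A) :
    p G K A * s G K e = s G K e := by
  rw [← p_source_mul_s, ← mul_assoc, p_mul_p_singleton hA h]

theorem p_mul_s_of_notMem {A : Set V} (hA : G.IsGenVertex A) {e : E} (h : G.source e ∉ A) :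
    p G K A * s G K e = 0 := by
  rw [← p_source_mul_s, ← mul_assoc, p_mul_p_singleton_of_notMem hA h, zero_mul]

/-- A subspace that contains the generators and is stable under left multiplication by the
generators is everything. -/
theorem eq_top_of_generators (W : Submodule K (G.LeavittPathAlgebra K))
    (hp : ∀ A, G.IsGenVertex A → p G K A ∈ W) (hs : ∀ e, s G K e ∈ W) (ht : ∀ e, t G K e ∈ W)
    (hpm : ∀ A, G.IsGenVertex A → ∀ x ∈ W, p G K A * x ∈ W)
    (hsm : ∀ e, ∀ x ∈ W, s G K e * x ∈ W) (htm : ∀ e, ∀ x ∈ W, t G K e * x ∈ W) : W = ⊤ := by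
  have hgen : ∀ g : G.Gen, mk G K (G.gen K g) ∈ W ∧ ∀ x ∈ W, mk G K (G.gen K g) * x ∈ W := by
    rintro (⟨A, hA⟩ | e | e)
    · have := hp A hA
      have h2 := hpm A hA
      rw [p_of hA] at this h2
      exact ⟨this, h2⟩
    · exact ⟨hs e, hsm e⟩
    · exact ⟨ht e, htm e⟩
  have hword : ∀ w : FreeSemigroup G.Gen,
      mk G K (MonoidAlgebra.single w (1 : K)) ∈ W := by
    intro w
    induction w using FreeSemigroup.recOnMul with
    | ih1 g => exact (hgen g).1
    | ih2 g w _ hw =>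
      have h := (hgen g).2 _ hw
      rwa [← map_mul, gen, MonoidAlgebra.single_mul_single, one_mul] at h
  rw [eq_top_iff]
  rintro x -
  obtain ⟨y, rfl⟩ := mk_surjective G K x
  induction y using MonoidAlgebra.induction_linear with
  | zero => rw [map_zero]; exact W.zero_mem
  | add a b ha hb => rw [map_add]; exact W.add_mem ha hb
  | single w k =>
    have : MonoidAlgebra.single w k = k • MonoidAlgebra.single w (1 : K) := by simp
    rw [this, mk_smul]
    exact W.smul_mem _ (hword w)

section Lift

variable {A : Type*} [NonUnitalRing A] [Module K A] [IsScalarTower K A A] [SMulCommClass K A A]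

/-- The homomorphism on the free algebra given by the images of the symbols. -/
noncomputable def freeLift (f : G.Gen → A) : G.FreeAlg K →ₙₐ[K] A :=
  MonoidAlgebra.liftMagma K (FreeSemigroup.lift f)

theorem freeLift_gen (f : G.Gen → A) (g : G.Gen) : freeLift f (G.gen K g) = f g := by
  simp [freeLift, gen]

/-- The universal property: images of the symbols that satisfy the defining relations give a
homomorphism. -/
noncomputable def lift (f : G.Gen → A)
    (hf : ∀ x y, G.Rel K x y → freeLift (K := K) f x = freeLift f y) :
    G.LeavittPathAlgebra K →ₙ+* A where
  toFun := Quotient.lift (freeLift f) fun x y h => by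
    have h' : RingConGen.Rel
      (fun x y => ∃ (k : K) (a b : G.FreeAlg K), G.Rel K a b ∧ x = k • a ∧ y = k • b) x y := h
    clear h
    induction h' with
    | of x y h =>
      obtain ⟨k, a, b, h, rfl, rfl⟩ := h
      rw [map_smul, map_smul, hf _ _ h]
    | refl => rfl
    | symm _ h => exact h.symm
    | trans _ _ h₁ h₂ => exact h₁.trans h₂
    | add _ _ h₁ h₂ => rw [map_add, map_add, h₁, h₂]
    | mul _ _ h₁ h₂ => rw [map_mul, map_mul, h₁, h₂]
  map_zero' := map_zero (freeLift f)
  map_add' := by rintro ⟨x⟩ ⟨y⟩; exact map_add (freeLift f) x y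
  map_mul' := by rintro ⟨x⟩ ⟨y⟩; exact map_mul (freeLift f) x y

theorem lift_mk (f : G.Gen → A) (hf) (x : G.FreeAlg K) :
    lift f hf (mk G K x) = freeLift f x := rfl

theorem lift_smul (f : G.Gen → A) (hf) (k : K) (x : G.LeavittPathAlgebra K) :
    lift f hf (k • x) = k • lift f hf x := by
  obtain ⟨x, rfl⟩ := mk_surjective G K x
  rw [← mk_smul, lift_mk, lift_mk, map_smul]

end Lift

end Basic

end LeavittPathAlgebra

end Ultragraph

/-! ### Ghost words and the filtration by leading edges -/

namespace Ultragraph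

variable {V E : Type*} (G : Ultragraph V E)

/-- The edges `e₁, …, eₙ` satisfy `source eᵢ ∈ range eᵢ₊₁` and `v ∈ range e₁`; that is, the
reversed list is a path whose range contains `v` (or empty). -/
def ReversePath : List E → V → Prop
  | [], _ => True
  | e :: g, v => v ∈ G.range e ∧ ReversePath g (G.source e)

namespace LeavittPathAlgebra

variable {G} {K : Type*} [Field K]

variable (G K) in
/-- The product of `p_A` and the ghost edges in the list. -/
noncomputable def ghostWord : Set V → List E → G.LeavittPathAlgebra K
  | A, [] => p G K A
  | A, e :: g => p G K A * (t G K e * ghostWord {G.source e} g)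

theorem p_mul_ghostWord {A B : Set V} (hA : G.IsGenVertex A) (hB : G.IsGenVertex B) (g : List E) :
    p G K A * ghostWord G K B g = ghostWord G K (A ∩ B) g := by
  cases g with
  | nil => exact p_mul_p hA hB
  | cons e g => rw [ghostWord, ← mul_assoc, p_mul_p hA hB, ghostWord]

theorem t_mul_ghostWord {A : Set V} (hA : G.IsGenVertex A) {e : E} (h : G.source e ∈ A)
    (g : List E) : t G K e * ghostWord G K A g = ghostWord G K (G.range e) (e :: g) := by
  rw [ghostWord, ← mul_assoc, p_range_mul_t, ← t_mul_p_source, mul_assoc,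
    p_mul_ghostWord (.singleton _) hA, Set.inter_eq_left.2 (by simpa), mul_assoc,
    p_mul_ghostWord (.singleton _) (.singleton _), Set.inter_self]

theorem t_mul_ghostWord_of_notMem {A : Set V} (hA : G.IsGenVertex A) {e : E}
    (h : G.source e ∉ A) (g : List E) : t G K e * ghostWord G K A g = 0 := by
  rw [← t_mul_p_source, mul_assoc, p_mul_ghostWord (.singleton _) hA,
    Set.singleton_inter_eq_empty.2 h]
  cases g <;> simp [ghostWord]

/-- Either `A` misses the range of the first ghost edge, and two adjacent projections multiply to
`p_∅`, or the remaining factor already vanishes. -/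
theorem ghostWord_eq_zero (g : List E) {A : Set V} (hA : G.IsGenVertex A)
    (h : ∀ v ∈ A, ¬ G.ReversePath g v) : ghostWord G K A g = 0 := by
  induction g generalizing A with
  | nil =>
    have : A = ∅ := Set.eq_empty_of_forall_notMem fun v hv => h v hv trivial
    rw [this, ghostWord, p_empty]
  | cons e g ih =>
    rw [ghostWord]
    by_cases hg : G.ReversePath g (G.source e)
    · rw [← p_range_mul_t, mul_assoc, ← mul_assoc, p_mul_p hA (.range e)]
      have : A ∩ G.range e = ∅ :=
        Set.eq_empty_of_forall_notMem fun v hv => h v hv.1 ⟨hv.2, hg⟩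
      rw [this, p_empty, zero_mul]
    · rw [ih (.singleton _) (by simpa using hg), mul_zero, mul_zero]

theorem p_eq_inter_add_diff {A B : Set V} (hA : G.IsGenVertex A) (hB : G.IsGenVertex B) :
    p G K A = p G K (A ∩ B) + p G K (A \ B) := by
  conv_lhs => rw [← Set.inter_union_sdiff A B]
  rw [p_union (hA.inter hB) (hA.diff hB), Set.disjoint_sdiff_inter.symm.inter_eq, p_empty,
    sub_zero]

theorem ghostWord_eq_inter_add_diff {A B : Set V} (hA : G.IsGenVertex A) (hB : G.IsGenVertex B)
    (g : List E) : ghostWord G K A g = ghostWord G K (A ∩ B) g + ghostWord G K (A \ B) g := by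
  cases g with
  | nil => exact p_eq_inter_add_diff hA hB
  | cons e g => simp only [ghostWord]; rw [p_eq_inter_add_diff hA hB, add_mul]

-- The sets `B i` may overlap, so the words need not be independent. Removing one set `B j` splits
-- `A` into `A ∩ B j`, where `k j` joins the constant `c`, and `A \ B j`, where it contributes
-- nothing. When no set is left, `c` must vanish as soon as some vertex of `A` admits `g`. The
-- constant and the set `A` are there for this induction.
open Classical in
theorem smul_ghostWord_add_sum_eq_zero {ι : Type*} (g : List E) (T : Finset ι) (B : ι → Set V)
    (k : ι → K) (hB : ∀ i ∈ T, G.IsGenVertex (B i)) (c : K) {A : Set V} (hA : G.IsGenVertex A)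
    (h : ∀ v ∈ A, G.ReversePath g v → c + ∑ i ∈ T, (if v ∈ B i then k i else 0) = 0) :
    c • ghostWord G K A g + ∑ i ∈ T, k i • ghostWord G K (A ∩ B i) g = 0 := by
  induction T using Finset.induction_on generalizing c A with
  | empty =>
    simp only [Finset.sum_empty, add_zero] at h ⊢
    by_cases hv : ∃ v ∈ A, G.ReversePath g v
    · obtain ⟨v, hv, hg⟩ := hv
      rw [h v hv hg, zero_smul]
    · push Not at hv
      rw [ghostWord_eq_zero g hA hv, smul_zero]
  | insert j T hj ih =>
    have hBj := hB j (Finset.mem_insert_self _ _)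
    have hB' : ∀ i ∈ T, G.IsGenVertex (B i) := fun i hi => hB i (Finset.mem_insert_of_mem hi)
    have h₁ := ih hB' (c + k j) (hA.inter hBj) fun v hv hg => by
      have := h v hv.1 hg
      rw [Finset.sum_insert hj, if_pos hv.2] at this
      rwa [add_assoc]
    have h₂ := ih hB' c (hA.diff hBj) fun v hv hg => by
      have := h v hv.1 hg
      rwa [Finset.sum_insert hj, if_neg hv.2, zero_add] at this
    have h₃ : ∑ i ∈ T, k i • ghostWord G K (A ∩ B i) g =
        ∑ i ∈ T, k i • ghostWord G K (A ∩ B j ∩ B i) g +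
        ∑ i ∈ T, k i • ghostWord G K (A \ B j ∩ B i) g := by
      rw [← Finset.sum_add_distrib]
      refine Finset.sum_congr rfl fun i hi => ?_
      rw [ghostWord_eq_inter_add_diff (hA.inter (hB' i hi)) hBj, smul_add,
        Set.inter_right_comm, Set.inter_sdiff_right_comm]
    rw [Finset.sum_insert hj, h₃, ghostWord_eq_inter_add_diff hA hBj]
    have h₄ := congrArg₂ (· + ·) h₁ h₂
    simp only [add_smul, add_zero] at h₄
    rw [smul_add, ← h₄]
    abel

theorem isGenVertex_biUnion {ι : Type*} (T : Finset ι) (B : ι → Set V)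
    (hB : ∀ i ∈ T, G.IsGenVertex (B i)) : G.IsGenVertex (⋃ i ∈ T, B i) := by
  classical
  induction T using Finset.induction_on with
  | empty => simpa using IsGenVertex.empty
  | insert j T _ ih =>
    rw [Finset.set_biUnion_insert]
    exact (hB j (Finset.mem_insert_self _ _)).union
      (ih fun i hi => hB i (Finset.mem_insert_of_mem hi))

-- A substitute for a basis of ghost words: a combination is recognised as zero from its
-- coefficients at single vertices.
open Classical in
theorem sum_ghostWord_eq_zero {ι : Type*} (g : List E) (T : Finset ι) (B : ι → Set V)
    (k : ι → K) (hB : ∀ i ∈ T, G.IsGenVertex (B i))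
    (h : ∀ v, G.ReversePath g v → ∑ i ∈ T, (if v ∈ B i then k i else 0) = 0) :
    ∑ i ∈ T, k i • ghostWord G K (B i) g = 0 := by
  have := smul_ghostWord_add_sum_eq_zero (K := K) g T B k hB 0 (isGenVertex_biUnion T B hB)
    fun v _ hg => by rw [zero_add, h v hg]
  rw [zero_smul, zero_add] at this
  rw [← this]
  refine Finset.sum_congr rfl fun i hi => ?_
  have hsub : B i ⊆ ⋃ i ∈ T, B i := fun v hv => Set.mem_iUnion₂.2 ⟨i, hi, hv⟩
  rw [Set.inter_eq_right.2 hsub]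

variable (G K) in
/-- The span of the ghost words. -/
noncomputable def ghostSpan : Submodule K (G.LeavittPathAlgebra K) :=
  Submodule.span K {x | ∃ A g, G.IsGenVertex A ∧ x = ghostWord G K A g}

variable (G K) in
/-- The span of the products of at most `n` edges followed by a ghost word. -/
noncomputable def filt : ℕ → Submodule K (G.LeavittPathAlgebra K)
  | 0 => ghostSpan G K
  | n + 1 => ghostSpan G K ⊔ ⨆ e, (filt n).map (LinearMap.mulLeft K (s G K e))

theorem ghostWord_mem_ghostSpan {A : Set V} (hA : G.IsGenVertex A) (g : List E) :
    ghostWord G K A g ∈ ghostSpan G K :=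
  Submodule.subset_span ⟨A, g, hA, rfl⟩

theorem ghostSpan_le_filt (n : ℕ) : ghostSpan G K ≤ filt G K n := by
  cases n with
  | zero => exact le_rfl
  | succ n => exact le_sup_left

theorem filt_mono : Monotone (filt G K) := by
  refine monotone_nat_of_le_succ fun n => ?_
  induction n with
  | zero => exact ghostSpan_le_filt _
  | succ n ih => exact sup_le_sup le_rfl (iSup_mono fun e => Submodule.map_mono ih)

theorem s_mul_mem_filt {n : ℕ} {x : G.LeavittPathAlgebra K} (hx : x ∈ filt G K n) (e : E) :
    s G K e * x ∈ filt G K (n + 1) :=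
  Submodule.mem_sup_right <| Submodule.mem_iSup_of_mem e <|
    Submodule.mem_map_of_mem (f := LinearMap.mulLeft K (s G K e)) hx

theorem filt_succ_induction {n : ℕ} {C : G.LeavittPathAlgebra K → Prop}
    (h0 : ∀ x ∈ ghostSpan G K, C x) (hs : ∀ e, ∀ x ∈ filt G K n, C (s G K e * x))
    (hadd : ∀ x y, C x → C y → C (x + y)) {x : G.LeavittPathAlgebra K}
    (hx : x ∈ filt G K (n + 1)) : C x := by
  obtain ⟨b, hb, c, hc, rfl⟩ := Submodule.mem_sup.1 hx
  refine hadd _ _ (h0 b hb) ?_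
  refine Submodule.iSup_induction (motive := C) _ hc ?_ (h0 0 (Submodule.zero_mem _)) hadd
  rintro e _ ⟨y, hy, rfl⟩
  exact hs e y hy

theorem ghostSpan_induction {C : G.LeavittPathAlgebra K → Prop}
    (hw : ∀ A g, G.IsGenVertex A → C (ghostWord G K A g))
    (hadd : ∀ x y, C x → C y → C (x + y)) (hsmul : ∀ (k : K) x, C x → C (k • x))
    {x : G.LeavittPathAlgebra K} (hx : x ∈ ghostSpan G K) : C x := by
  have h0 : C 0 := by simpa using hsmul 0 _ (hw ∅ [] .empty)
  refine Submodule.span_induction (p := fun x _ => C x) ?_ h0 (fun x y _ _ => hadd x y)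
    (fun k x _ => hsmul k x) hx
  rintro _ ⟨A, g, hA, rfl⟩
  exact hw A g hA

theorem p_mul_mem_filt {A : Set V} (hA : G.IsGenVertex A) {n : ℕ} {x : G.LeavittPathAlgebra K}
    (hx : x ∈ filt G K n) : p G K A * x ∈ filt G K n := by
  have h0 : ∀ x ∈ ghostSpan G K, p G K A * x ∈ ghostSpan G K := fun x hx => by
    refine ghostSpan_induction (C := fun x => p G K A * x ∈ ghostSpan G K) ?_ ?_ ?_ hx
    · intro B g hB
      rw [p_mul_ghostWord hA hB]
      exact ghostWord_mem_ghostSpan (hA.inter hB) g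
    · intro x y hx hy
      rw [mul_add]
      exact Submodule.add_mem _ hx hy
    · intro k x hx
      rw [mul_smul_comm]
      exact Submodule.smul_mem _ k hx
  cases n with
  | zero => exact h0 x hx
  | succ n =>
    refine filt_succ_induction (C := fun x => p G K A * x ∈ filt G K (n + 1)) ?_ ?_ ?_ hx
    · exact fun x hx => ghostSpan_le_filt _ (h0 x hx)
    · intro e x hx
      rw [← mul_assoc]
      by_cases h : G.source e ∈ A
      · rw [p_mul_s hA h]
        exact s_mul_mem_filt hx e
      · rw [p_mul_s_of_notMem hA h, zero_mul]
        exact Submodule.zero_mem _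
    · intro x y hx hy
      rw [mul_add]
      exact Submodule.add_mem _ hx hy

theorem t_mul_mem_ghostSpan (e : E) {x : G.LeavittPathAlgebra K} (hx : x ∈ ghostSpan G K) :
    t G K e * x ∈ ghostSpan G K := by
  refine ghostSpan_induction (C := fun x => t G K e * x ∈ ghostSpan G K) ?_ ?_ ?_ hx
  · intro B g hB
    by_cases h : G.source e ∈ B
    · rw [t_mul_ghostWord hB h]
      exact ghostWord_mem_ghostSpan (.range e) _
    · rw [t_mul_ghostWord_of_notMem hB h]
      exact Submodule.zero_mem _
  · intro x y hx hy
    rw [mul_add]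
    exact Submodule.add_mem _ hx hy
  · intro k x hx
    rw [mul_smul_comm]
    exact Submodule.smul_mem _ k hx

/-- A ghost edge cancels the leading edge or annihilates the product, and it turns ghost words into
ghost words. This drop in degree drives the induction for faithfulness. -/
theorem t_mul_mem_filt (e : E) {n : ℕ} {x : G.LeavittPathAlgebra K}
    (hx : x ∈ filt G K (n + 1)) : t G K e * x ∈ filt G K n := by
  refine filt_succ_induction (C := fun x => t G K e * x ∈ filt G K n) ?_ ?_ ?_ hx
  · exact fun x hx => ghostSpan_le_filt _ (t_mul_mem_ghostSpan e hx)
  · intro f x hx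
    rw [← mul_assoc]
    by_cases h : e = f
    · rw [← h, t_mul_s]
      exact p_mul_mem_filt (.range e) hx
    · rw [t_mul_s_of_ne h, zero_mul]
      exact Submodule.zero_mem _
  · intro x y hx hy
    rw [mul_add]
    exact Submodule.add_mem _ hx hy

/-- Only left multiplication by generators has to be checked: projections preserve each stage, an
edge raises it by one, a ghost edge does not raise it. -/
theorem exists_mem_filt (x : G.LeavittPathAlgebra K) : ∃ n, x ∈ filt G K n := by
  have hmem : ∀ {y}, y ∈ ⨆ n, filt G K n ↔ ∃ n, y ∈ filt G K n :=
    Submodule.mem_iSup_of_directed _ filt_mono.directed_le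
  have ht : ∀ e, t G K e ∈ ghostSpan G K := fun e => by
    have := ghostWord_mem_ghostSpan (K := K) (IsGenVertex.range (G := G) e) [e]
    rwa [ghostWord, ghostWord, t_mul_p_source, p_range_mul_t] at this
  rw [← hmem, eq_top_of_generators (⨆ n, filt G K n)]
  · trivial
  · exact fun A hA => hmem.2 ⟨0, ghostWord_mem_ghostSpan hA []⟩
  · intro e
    rw [← s_mul_p_range]
    exact hmem.2 ⟨1, s_mul_mem_filt (n := 0) (ghostWord_mem_ghostSpan (.range e) []) e⟩
  · exact fun e => hmem.2 ⟨0, ht e⟩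
  · intro A hA x hx
    obtain ⟨n, hn⟩ := hmem.1 hx
    exact hmem.2 ⟨n, p_mul_mem_filt hA hn⟩
  · intro e x hx
    obtain ⟨n, hn⟩ := hmem.1 hx
    exact hmem.2 ⟨n + 1, s_mul_mem_filt hn e⟩
  · intro e x hx
    obtain ⟨n, hn⟩ := hmem.1 hx
    exact hmem.2 ⟨n, t_mul_mem_filt e (filt_mono n.le_succ hn)⟩

end LeavittPathAlgebra

/-- The one-step relation gives concatenation and induction from either end without work on lists.
-/
theorem reaches_iff_reflTransGen {v w : V} : G.Reaches v w ↔
    Relation.ReflTransGen (fun a b => ∃ e, G.source e = a ∧ b ∈ G.range e) v w := by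
  constructor
  · rintro (rfl | ⟨α, h, hα, rfl, hw⟩)
    · exact .refl
    · obtain ⟨-, hc⟩ := hα
      induction α with
      | nil => exact absurd rfl h
      | cons e α ih =>
        cases α with
        | nil => exact .single ⟨e, rfl, hw⟩
        | cons f α =>
          rw [List.isChain_cons_cons] at hc
          exact .head ⟨e, rfl, hc.1⟩ (ih (by simp) hw hc.2)
  · intro h
    induction h using Relation.ReflTransGen.head_induction_on with
    | refl => exact .inl rfl
    | head h _ ih =>
      obtain ⟨e, rfl, he⟩ := h
      right
      obtain rfl | ⟨α, h, hα, rfl, hw⟩ := ih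
      · exact ⟨[e], by simp, ⟨by simp, by simp⟩, rfl, by simpa⟩
      · refine ⟨e :: α, by simp, ⟨by simp, ?_⟩, rfl, by rwa [List.getLast_cons h]⟩
        cases α with
        | nil => exact absurd rfl h
        | cons f α => exact List.isChain_cons_cons.2 ⟨he, hα.2⟩

end Ultragraph

/-! ### Branching systems, their representations, and boundary paths -/

namespace Ultragraph

variable {V E : Type*} (G : Ultragraph V E)

/-- The source of a label: a vertex is its own source. -/
def labelSource : V ⊕ E → V := Sum.elim id G.source

/-- A set with a partial left inverse `tail` to prepending edges, on which the Leavitt path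
algebra acts. The label of a point is its first edge, or a sink if there is no such edge. -/
structure BranchingSystem (Y : Type*) where
  label : Y → V ⊕ E
  tail : Y → Y
  cons : E → Y → Y
  isSink_of_label {y : Y} {w : V} : label y = .inl w → G.IsSink w
  source_tail_mem {y : Y} {e : E} : label y = .inr e → G.labelSource (label (tail y)) ∈ G.range e
  label_cons {e : E} {y : Y} : G.labelSource (label y) ∈ G.range e → label (cons e y) = .inr e
  tail_cons {e : E} {y : Y} : G.labelSource (label y) ∈ G.range e → tail (cons e y) = y
  cons_tail {e : E} {y : Y} : label y = .inr e → cons e (tail y) = y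

namespace BranchingSystem

variable {G} {Y : Type*} (B : G.BranchingSystem Y)

/-- The source of a point. -/
def src (y : Y) : V := G.labelSource (B.label y)

variable {B} in
theorem src_of_label {y : Y} {e : E} (h : B.label y = .inr e) : B.src y = G.source e := by
  rw [src, h]; rfl

variable {B} in
theorem src_cons {e : E} {y : Y} (h : B.src y ∈ G.range e) : B.src (B.cons e y) = G.source e :=
  src_of_label (B.label_cons h)

variable {B} in
theorem src_tail_mem {y : Y} {e : E} (h : B.label y = .inr e) : B.src (B.tail y) ∈ G.range e :=
  B.source_tail_mem h

variable {B} in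
theorem exists_label_of_not_isSink {y : Y} (h : ¬ G.IsSink (B.src y)) :
    ∃ e, B.label y = .inr e := by
  match hy : B.label y with
  | .inl w =>
    rw [src, hy] at h
    exact absurd (B.isSink_of_label hy) h
  | .inr e => exact ⟨e, rfl⟩

section Representation

variable (K : Type*) [Field K]

open Classical in
/-- The operators by which the generators act. -/
noncomputable def op : G.Gen → Module.End K (Y →₀ K)
  | .vert A => Finsupp.linearCombination K fun y =>
      if B.src y ∈ A.1 then Finsupp.single y 1 else 0
  | .edge e => Finsupp.linearCombination K fun y =>
      if B.src y ∈ G.range e then Finsupp.single (B.cons e y) 1 else 0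
  | .ghost e => Finsupp.linearCombination K fun y =>
      if B.label y = .inr e then Finsupp.single (B.tail y) 1 else 0

open Classical in
theorem op_vert (A : G.GenVertex) (y : Y) : B.op K (.vert A) (Finsupp.single y 1) =
    if B.src y ∈ A.1 then Finsupp.single y 1 else 0 := by
  simp [op]

open Classical in
theorem op_edge (e : E) (y : Y) : B.op K (.edge e) (Finsupp.single y 1) =
    if B.src y ∈ G.range e then Finsupp.single (B.cons e y) 1 else 0 := by
  simp [op]

open Classical in
theorem op_ghost (e : E) (y : Y) : B.op K (.ghost e) (Finsupp.single y 1) =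
    if B.label y = .inr e then Finsupp.single (B.tail y) 1 else 0 := by
  simp [op]

open Classical in
theorem freeLift_P {A : Set V} (hA : G.IsGenVertex A) (y : Y) :
    LeavittPathAlgebra.freeLift (K := K) (B.op K) (G.P K A hA) (Finsupp.single y 1) =
      if B.src y ∈ A then Finsupp.single y 1 else 0 := by
  rw [P, LeavittPathAlgebra.freeLift_gen]
  exact B.op_vert K ⟨A, hA⟩ y

open Classical in
theorem freeLift_S (e : E) (y : Y) :
    LeavittPathAlgebra.freeLift (K := K) (B.op K) (G.S K e) (Finsupp.single y 1) =
      if B.src y ∈ G.range e then Finsupp.single (B.cons e y) 1 else 0 := by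
  rw [S, LeavittPathAlgebra.freeLift_gen, op_edge]

open Classical in
theorem freeLift_Sstar (e : E) (y : Y) :
    LeavittPathAlgebra.freeLift (K := K) (B.op K) (G.Sstar K e) (Finsupp.single y 1) =
      if B.label y = .inr e then Finsupp.single (B.tail y) 1 else 0 := by
  rw [Sstar, LeavittPathAlgebra.freeLift_gen, op_ghost]

theorem op_rel (a b : G.FreeAlg K) (h : G.Rel K a b) :
    LeavittPathAlgebra.freeLift (K := K) (B.op K) a =
      LeavittPathAlgebra.freeLift (B.op K) b := by
  classical
  induction h with
  | p_empty =>
    rw [map_zero]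
    ext1 y
    ext1
    simp [freeLift_P]
  | p_inter hA hB =>
    simp only [map_mul]
    ext1 y
    ext1
    simp only [LinearMap.comp_apply, Finsupp.lsingle_apply, Module.End.mul_apply, freeLift_P,
      Set.mem_inter_iff]
    split_ifs <;> simp_all [freeLift_P]
  | p_union hA hB =>
    simp only [map_add, map_sub]
    ext1 y
    ext1
    simp only [LinearMap.comp_apply, Finsupp.lsingle_apply, LinearMap.add_apply,
      LinearMap.sub_apply, freeLift_P, Set.mem_inter_iff, Set.mem_union]
    split_ifs <;> simp_all
  | source_s e =>
    simp only [map_mul]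
    ext1 y
    ext1
    simp only [LinearMap.comp_apply, Finsupp.lsingle_apply, Module.End.mul_apply, freeLift_S]
    split_ifs with h
    · simp [freeLift_P, src_cons h]
    · simp
  | s_range e =>
    simp only [map_mul]
    ext1 y
    ext1
    simp only [LinearMap.comp_apply, Finsupp.lsingle_apply, Module.End.mul_apply, freeLift_P]
    split_ifs with h
    · rfl
    · simp [freeLift_S, h]
  | range_sstar e =>
    simp only [map_mul]
    ext1 y
    ext1
    simp only [LinearMap.comp_apply, Finsupp.lsingle_apply, Module.End.mul_apply, freeLift_Sstar]
    split_ifs with h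
    · rw [freeLift_P, if_pos]
      exact B.source_tail_mem h
    · simp
  | sstar_source e =>
    simp only [map_mul]
    ext1 y
    ext1
    simp only [LinearMap.comp_apply, Finsupp.lsingle_apply, Module.End.mul_apply, freeLift_P]
    split_ifs with h
    · rfl
    · rw [freeLift_Sstar, if_neg, map_zero]
      exact fun h' => h (src_of_label h')
  | sstar_s_self e =>
    simp only [map_mul]
    ext1 y
    ext1
    simp only [LinearMap.comp_apply, Finsupp.lsingle_apply, Module.End.mul_apply, freeLift_P,
      freeLift_S]
    split_ifs with h
    · rw [freeLift_Sstar, if_pos (B.label_cons h), B.tail_cons h]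
    · simp
  | sstar_s_ne hne =>
    simp only [map_mul, map_zero]
    ext1 y
    ext1
    simp only [LinearMap.comp_apply, Finsupp.lsingle_apply, Module.End.mul_apply,
      freeLift_S]
    split_ifs with h
    · rw [freeLift_Sstar, B.label_cons h, if_neg, LinearMap.zero_apply]
      exact fun h' => hne (Sum.inr_injective h').symm
    · simp
  -- `s_e s_e^*` projects onto the points with label `e`. A point whose source emits an edge has
  -- exactly one edge as its label, so exactly one summand fixes it.
  | regular v hfin hne =>
    simp only [map_mul, map_sum]
    ext1 y
    ext1
    have key : ∀ e, LeavittPathAlgebra.freeLift (K := K) (B.op K) (G.S K e)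
        (LeavittPathAlgebra.freeLift (K := K) (B.op K) (G.Sstar K e) (Finsupp.single y 1)) =
        if B.label y = .inr e then Finsupp.single y 1 else 0 := by
      intro e
      rw [freeLift_Sstar]
      split_ifs with h
      · rw [freeLift_S, if_pos (src_tail_mem h), B.cons_tail h]
      · simp
    simp only [LinearMap.comp_apply, Finsupp.lsingle_apply, Module.End.mul_apply, freeLift_P,
      LinearMap.sum_apply, key, Set.mem_singleton_iff]
    split_ifs with h
    · subst h
      obtain ⟨f, hf⟩ := hne
      obtain ⟨e, he⟩ := exists_label_of_not_isSink (B := B) (y := y) fun hs => hs f hf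
      rw [Finset.sum_eq_single e, if_pos he]
      · intro f _ hf
        rw [he, if_neg]
        exact fun h' => hf (Sum.inr_injective h').symm
      · intro h'
        exact absurd (by simpa using (src_of_label he).symm) h'
    · refine (Finset.sum_eq_zero fun e he => if_neg fun h' => h ?_).symm
      rw [src_of_label h']
      simpa using he

/-- The representation of the Leavitt path algebra on the vector space with basis `Y`. -/
noncomputable def rep : G.LeavittPathAlgebra K →ₙ+* Module.End K (Y →₀ K) :=
  LeavittPathAlgebra.lift (B.op K) (B.op_rel K)

variable {K}

theorem rep_smul (k : K) (x : G.LeavittPathAlgebra K) : B.rep K (k • x) = k • B.rep K x :=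
  LeavittPathAlgebra.lift_smul _ _ _ _

open Classical in
theorem rep_p {A : Set V} (hA : G.IsGenVertex A) (y : Y) :
    B.rep K (LeavittPathAlgebra.p G K A) (Finsupp.single y 1) =
      if B.src y ∈ A then Finsupp.single y 1 else 0 := by
  rw [LeavittPathAlgebra.p_of hA, rep, LeavittPathAlgebra.lift_mk, freeLift_P]

open Classical in
theorem rep_s (e : E) (y : Y) :
    B.rep K (LeavittPathAlgebra.s G K e) (Finsupp.single y 1) =
      if B.src y ∈ G.range e then Finsupp.single (B.cons e y) 1 else 0 := by
  rw [LeavittPathAlgebra.s, rep, LeavittPathAlgebra.lift_mk, freeLift_S]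

open Classical in
theorem rep_t (e : E) (y : Y) :
    B.rep K (LeavittPathAlgebra.t G K e) (Finsupp.single y 1) =
      if B.label y = .inr e then Finsupp.single (B.tail y) 1 else 0 := by
  rw [LeavittPathAlgebra.t, rep, LeavittPathAlgebra.lift_mk, freeLift_Sstar]

end Representation

end BranchingSystem

/-- The boundary paths that start at a vertex and never stop before they reach a sink, as
sequences of edges; a path that reaches a sink `w` is continued by `w, w, …`. -/
@[ext] structure BoundaryPath where
  seq : ℕ → V ⊕ E
  valid (n : ℕ) : (∀ w, seq n = .inl w → G.IsSink w ∧ seq (n + 1) = .inl w) ∧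
    ∀ e, seq n = .inr e → G.labelSource (seq (n + 1)) ∈ G.range e

namespace BoundaryPath

variable {G}

/-- The boundary path without its first edge. -/
def tail (y : G.BoundaryPath) : G.BoundaryPath := ⟨fun n => y.seq (n + 1), fun n => y.valid (n + 1)⟩

theorem tail_iterate (n : ℕ) (y : G.BoundaryPath) (m : ℕ) : (tail^[n] y).seq m = y.seq (m + n) := by
  induction n generalizing y with
  | zero => rfl
  | succ n ih =>
    rw [Function.iterate_succ_apply, ih]
    exact congrArg y.seq (by omega)

open Classical in
/-- The boundary path with an edge put in front; a junk value if that is impossible. -/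
noncomputable def cons (e : E) (y : G.BoundaryPath) : G.BoundaryPath :=
  if h : G.labelSource (y.seq 0) ∈ G.range e then
    ⟨fun n => n.casesOn (.inr e) y.seq, by
      rintro (_ | n)
      · refine ⟨fun w hw => by simp at hw, fun f hf => ?_⟩
        obtain rfl := Sum.inr_injective hf
        exact h
      · exact y.valid n⟩
  else y

variable (G) in
/-- The branching system of all boundary paths. -/
noncomputable def system : G.BranchingSystem G.BoundaryPath where
  label y := y.seq 0
  tail := tail
  cons := cons
  isSink_of_label {y w} h := ((y.valid 0).1 w h).1
  source_tail_mem {y e} h := (y.valid 0).2 e h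
  label_cons h := by rw [cons, dif_pos h]; rfl
  tail_cons h := by rw [cons, dif_pos h]; rfl
  cons_tail {e y} h := by
    have h' : G.labelSource ((tail y).seq 0) ∈ G.range e := (y.valid 0).2 e h
    rw [cons, dif_pos h']
    apply BoundaryPath.ext
    funext n
    cases n with
    | zero => exact h.symm
    | succ n => rfl

theorem tail_of_label {y : G.BoundaryPath} {w : V} (h : (system G).label y = .inl w) :
    tail y = y := by
  have key : ∀ n, y.seq n = .inl w := by
    intro n
    induction n with
    | zero => exact h
    | succ n ih => exact ((y.valid n).1 w ih).2
  apply BoundaryPath.ext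
  funext n
  exact (key (n + 1)).trans (key n).symm

theorem ext_label {y z : G.BoundaryPath}
    (h : ∀ n, (system G).label (tail^[n] y) = (system G).label (tail^[n] z)) : y = z := by
  apply BoundaryPath.ext
  funext n
  have := h n
  change (tail^[n] y).seq 0 = (tail^[n] z).seq 0 at this
  rwa [tail_iterate, tail_iterate, zero_add] at this

/-- The boundary path produced by a deterministic automaton. -/
def ofStep {σ : Type*} (lab : σ → V ⊕ E) (next : σ → σ)
    (h : ∀ a, (∀ w, lab a = .inl w → G.IsSink w ∧ lab (next a) = .inl w) ∧
      ∀ e, lab a = .inr e → G.labelSource (lab (next a)) ∈ G.range e) (a : σ) :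
    G.BoundaryPath :=
  ⟨fun n => lab (next^[n] a), fun n => by
    simp only [Function.iterate_succ_apply']
    exact h _⟩

variable (G) in
open Classical in
/-- The label of a vertex: an edge that it emits, or the vertex itself if it is a sink. -/
noncomputable def vertexLabel (v : V) : V ⊕ E :=
  if h : ∃ e, G.source e = v then .inr h.choose else .inl v

theorem labelSource_vertexLabel (v : V) : G.labelSource (vertexLabel G v) = v := by
  unfold vertexLabel
  split_ifs with h
  · exact h.choose_spec
  · rfl

theorem isSink_of_vertexLabel {v w : V} (h : vertexLabel G v = .inl w) :
    G.IsSink v ∧ v = w := by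
  unfold vertexLabel at h
  split_ifs at h with h'
  exact ⟨fun e he => h' ⟨e, he⟩, Sum.inl_injective h⟩

variable (G) in
open Classical in
/-- A vertex in the range of the chosen edge that `v` emits, or `v` itself if `v` is a sink. -/
noncomputable def nextVertex (v : V) : V :=
  if h : ∃ e, G.source e = v then (G.range_nonempty h.choose).choose else v

theorem nextVertex_mem {v : V} {e : E} (h : vertexLabel G v = .inr e) :
    nextVertex G v ∈ G.range e := by
  unfold vertexLabel at h
  split_ifs at h with h'
  rw [nextVertex, dif_pos h', ← Sum.inr_injective h]
  exact (G.range_nonempty h'.choose).choose_spec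

theorem nextVertex_of_isSink {v : V} (h : G.IsSink v) : nextVertex G v = v := by
  rw [nextVertex, dif_neg]
  rintro ⟨e, he⟩
  exact h e he

/-- Follow chosen edges, and chosen vertices in their ranges, for ever or until a sink is met. -/
theorem exists_src_eq (v : V) : ∃ y : G.BoundaryPath, (system G).src y = v := by
  refine ⟨ofStep (vertexLabel G) (nextVertex G) ?_ v, labelSource_vertexLabel v⟩
  refine fun a => ⟨fun w hw => ?_, fun e he => ?_⟩
  · obtain ⟨h, rfl⟩ := isSink_of_vertexLabel hw
    exact ⟨h, by rw [nextVertex_of_isSink h, hw]⟩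
  · rw [labelSource_vertexLabel]
    exact nextVertex_mem he

end BoundaryPath

end Ultragraph

/-! ### Simplicity of the module of a tail class -/

namespace Ultragraph

variable {V E : Type*} {G : Ultragraph V E}

namespace BranchingSystem

variable {Y : Type*} (B : G.BranchingSystem Y)

/-- The points are separated by their sequences of labels. -/
def Separated : Prop :=
  ∀ y z, (∀ n, B.label (B.tail^[n] y) = B.label (B.tail^[n] z)) → y = z

/-- The action of the Leavitt path algebra on the vector space with basis `Y`. -/
noncomputable def action (K : Type*) [Field K] :
    G.LeavittPathAlgebra K →ₙ+* AddMonoid.End (Y →₀ K) where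
  toFun x := (B.rep K x).toAddMonoidHom
  map_zero' := by rw [map_zero]; rfl
  map_add' x y := by rw [map_add]; rfl
  map_mul' x y := by rw [map_mul]; rfl

variable {K : Type*} [Field K]

theorem action_apply (x : G.LeavittPathAlgebra K) (m : Y →₀ K) :
    B.action K x m = B.rep K x m := rfl

theorem rep_single (x : G.LeavittPathAlgebra K) (y : Y) (k : K) :
    B.rep K x (Finsupp.single y k) = k • B.rep K x (Finsupp.single y 1) := by
  rw [← map_smul, Finsupp.smul_single, smul_eq_mul, mul_one]

open LeavittPathAlgebra

variable (K) in
open Classical in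
/-- Some element of the Leavitt path algebra acts as the projection onto the span of `T`. -/
def IsProjection (T : Set Y) : Prop := ∃ x : G.LeavittPathAlgebra K,
  ∀ y, B.rep K x (Finsupp.single y 1) = if y ∈ T then Finsupp.single y 1 else 0

open Classical in
theorem isProjection_src (v : V) : B.IsProjection K {y | B.src y = v} :=
  ⟨p G K {v}, fun y => by simp [rep_p B (.singleton v)]⟩

variable {B}

/-- Conjugation to `s_e x s_e^*` moves the test performed by `x` behind the edge `e`. -/
theorem IsProjection.cons {T : Set Y} (h : B.IsProjection K T) (e : E) :
    B.IsProjection K {y | B.label y = .inr e ∧ B.tail y ∈ T} := by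
  classical
  obtain ⟨x, hx⟩ := h
  refine ⟨s G K e * x * t G K e, fun y => ?_⟩
  rw [map_mul, map_mul, Module.End.mul_apply, Module.End.mul_apply, rep_t]
  by_cases h₁ : B.label y = .inr e
  · rw [if_pos h₁, hx]
    by_cases h₂ : B.tail y ∈ T
    · rw [if_pos h₂, rep_s, if_pos (src_tail_mem h₁), B.cons_tail h₁, if_pos ⟨h₁, h₂⟩]
    · rw [if_neg h₂, map_zero, if_neg fun h => h₂ h.2]
  · rw [if_neg h₁, map_zero, map_zero, if_neg fun h => h₁ h.1]

variable (K) in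
theorem isProjection_label (e : E) : B.IsProjection K {y | B.label y = .inr e} := by
  classical
  have : B.IsProjection K {y | B.src y ∈ G.range e} :=
    ⟨p G K (G.range e), fun y => by simp [rep_p B (.range e)]⟩
  convert this.cons e using 3 with y
  exact ⟨fun h => ⟨h, B.source_tail_mem h⟩, And.left⟩

-- Different sources are told apart by a vertex projection. If the sources agree, at least one label
-- is an edge, since two sinks with the same source coincide.
variable (K) in
theorem exists_isProjection_of_label_ne {y z : Y} (h : B.label y ≠ B.label z) :
    ∃ T, B.IsProjection K T ∧ ¬ (y ∈ T ↔ z ∈ T) := by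
  by_cases hsrc : B.src y = B.src z
  · match hy : B.label y, hz : B.label z with
    | .inr e, _ =>
      refine ⟨_, isProjection_label K e, fun h' => h ?_⟩
      exact hy.trans (h'.1 hy).symm
    | _, .inr e =>
      refine ⟨_, isProjection_label K e, fun h' => h ?_⟩
      exact (h'.2 hz).trans hz.symm
    | .inl v, .inl w =>
      rw [src, src, hy, hz] at hsrc
      exact absurd (hy.trans ((congrArg Sum.inl hsrc).trans hz.symm)) h
  · exact ⟨_, B.isProjection_src (B.src y), fun h' => hsrc (h'.1 rfl).symm⟩

-- Induction on a position where the labels differ: a common first edge is put in front of a set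
-- that separates the tails, and a point labelled by a sink is its own tail.
variable (K) in
theorem exists_isProjection (hB : B.Separated)
    (hsink : ∀ y w, B.label y = .inl w → B.tail y = y) {y z : Y} (h : y ≠ z) :
    ∃ T, B.IsProjection K T ∧ ¬ (y ∈ T ↔ z ∈ T) := by
  obtain ⟨n, hn⟩ : ∃ n, B.label (B.tail^[n] y) ≠ B.label (B.tail^[n] z) := by
    by_contra! h'
    exact h (hB y z h')
  clear h
  induction n generalizing y z with
  | zero => exact exists_isProjection_of_label_ne K hn
  | succ n ih =>
    by_cases h : B.label y = B.label z
    · rw [Function.iterate_succ_apply, Function.iterate_succ_apply] at hn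
      match hy : B.label y with
      | .inl w =>
        rw [hsink y w hy, hsink z w (h ▸ hy)] at hn
        exact ih hn
      | .inr e =>
        obtain ⟨T, hT, h'⟩ := ih hn
        refine ⟨_, hT.cons e, fun h'' => h' ?_⟩
        simpa [hy, ← h] using h''
    · exact exists_isProjection_of_label_ne K h

open Classical in
theorem rep_eq_filter {T : Set Y} {x : G.LeavittPathAlgebra K}
    (hx : ∀ y, B.rep K x (Finsupp.single y 1) = if y ∈ T then Finsupp.single y 1 else 0)
    (m : Y →₀ K) : B.rep K x m = m.filter (· ∈ T) := by
  induction m using Finsupp.induction_linear with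
  | zero => rw [map_zero, Finsupp.filter_zero]
  | add m m' h h' => rw [map_add, h, h', Finsupp.filter_add]
  | single y k =>
    rw [rep_single, hx]
    split_ifs with h
    · rw [Finsupp.filter_single_of_pos _ h, Finsupp.smul_single, smul_eq_mul, mul_one]
    · rw [Finsupp.filter_single_of_neg _ h, smul_zero]

/-- A projection that separates two points of the support cuts the vector down to a nonzero one with
smaller support. -/
theorem exists_single_mem (hB : B.Separated)
    (hsink : ∀ y w, B.label y = .inl w → B.tail y = y) (N : AddSubgroup (Y →₀ K))
    (hN : ∀ x : G.LeavittPathAlgebra K, ∀ m ∈ N, B.rep K x m ∈ N) (m : Y →₀ K) (hm : m ∈ N)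
    (hm0 : m ≠ 0) : ∃ y, ∃ k : K, k ≠ 0 ∧ Finsupp.single y k ∈ N := by
  classical
  induction hn : m.support.card using Nat.strong_induction_on generalizing m with
  | _ n ih =>
    by_cases hsub : ∃ y ∈ m.support, ∃ z ∈ m.support, y ≠ z
    · obtain ⟨y, hy, z, hz, hyz⟩ := hsub
      obtain ⟨T, ⟨x, hx⟩, hT⟩ := exists_isProjection K hB hsink hyz
      obtain ⟨a, ha, haT, b, hb, hbT⟩ :
          ∃ a ∈ m.support, a ∈ T ∧ ∃ b ∈ m.support, b ∉ T := by
        by_cases h : y ∈ T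
        · exact ⟨y, hy, h, z, hz, fun h' => hT ⟨fun _ => h', fun _ => h⟩⟩
        · exact ⟨z, hz, by tauto, y, hy, h⟩
      refine ih _ ?_ (m.filter (· ∈ T)) (rep_eq_filter hx m ▸ hN x m hm) ?_ rfl
      · rw [← hn, Finsupp.support_filter]
        exact Finset.card_lt_card (Finset.filter_ssubset.2 ⟨b, hb, hbT⟩)
      · intro h
        have := DFunLike.congr_fun h a
        rw [Finsupp.filter_apply_pos _ _ haT] at this
        exact Finsupp.mem_support_iff.1 ha this
    · push Not at hsub
      obtain ⟨y, hy⟩ := Finsupp.support_nonempty_iff.2 hm0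
      refine ⟨y, m y, Finsupp.mem_support_iff.1 hy, ?_⟩
      convert hm
      refine (Finsupp.support_subset_singleton.1 fun z hz => ?_).symm
      rw [Finset.mem_singleton, hsub y hy z hz]

/-- A nonzero submodule contains a multiple of a basis vector. Ghost edges and edges lead from a
point to its tail and back, and any two points share a tail, so all basis vectors follow. -/
theorem isSimpleAction_action [Nonempty Y] (hB : B.Separated)
    (hsink : ∀ y w, B.label y = .inl w → B.tail y = y)
    (htail : ∀ y z, ∃ m n, B.tail^[m] y = B.tail^[n] z) : IsSimpleAction (B.action K) := by
  classical
  constructor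
  · obtain ⟨y⟩ := ‹Nonempty Y›
    refine ⟨p G K {B.src y}, Finsupp.single y 1, ?_⟩
    rw [action_apply, rep_p _ (.singleton _), if_pos (Set.mem_singleton _)]
    simp
  · intro N hN
    rw [or_iff_not_imp_left]
    intro hne
    obtain ⟨m, hm, hm0⟩ := N.bot_or_exists_ne_zero.resolve_left hne
    obtain ⟨y, k, hk, hy⟩ := exists_single_mem hB hsink N hN m hm hm0
    -- `N` is only an additive subgroup; scalars enter through `c • p_v`, which multiplies the basis
    -- vectors with source `v` by `c`.
    have hscal : ∀ z, Finsupp.single z 1 ∈ N → ∀ c : K, Finsupp.single z c ∈ N := by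
      intro z hz c
      have := hN (c • p G K {B.src z}) _ hz
      rwa [action_apply, rep_smul, LinearMap.smul_apply, rep_p _ (.singleton _), if_pos (Set.mem_singleton _),
        Finsupp.smul_single, smul_eq_mul, mul_one] at this
    have hy1 : Finsupp.single y 1 ∈ N := by
      have := hN (k⁻¹ • p G K {B.src y}) _ hy
      rwa [action_apply, rep_smul, LinearMap.smul_apply, rep_single, rep_p _ (.singleton _),
        if_pos (Set.mem_singleton _), Finsupp.smul_single, Finsupp.smul_single, smul_eq_mul, smul_eq_mul, mul_one,
        inv_mul_cancel₀ hk] at this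
    have htl : ∀ z, Finsupp.single z 1 ∈ N ↔ Finsupp.single (B.tail z) 1 ∈ N := by
      intro z
      match hz : B.label z with
      | .inl w => rw [hsink z w hz]
      | .inr e =>
        constructor <;> intro h
        · have := hN (t G K e) _ h
          rwa [action_apply, rep_t, if_pos hz] at this
        · have := hN (s G K e) _ h
          rwa [action_apply, rep_s, if_pos (src_tail_mem hz), B.cons_tail hz] at this
    have htl' : ∀ n z, Finsupp.single z 1 ∈ N ↔ Finsupp.single (B.tail^[n] z) 1 ∈ N := by
      intro n
      induction n with
      | zero => exact fun z => Iff.rfl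
      | succ n ih => exact fun z => (htl z).trans (ih (B.tail z))
    have hall : ∀ z, Finsupp.single z 1 ∈ N := by
      intro z
      obtain ⟨a, b, h⟩ := htail y z
      rw [htl' b, ← h, ← htl']
      exact hy1
    rw [eq_top_iff]
    rintro m -
    induction m using Finsupp.induction_linear with
    | zero => exact N.zero_mem
    | add _ _ h h' => exact N.add_mem h h'
    | single z c => exact hscal z (hall z) c

variable (B) in
/-- The branching system in which the points carry a degree. -/
def graded : G.BranchingSystem (Y × ℤ) where
  label y := B.label y.1
  tail y := (B.tail y.1, y.2 - 1)
  cons e y := (B.cons e y.1, y.2 + 1)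
  isSink_of_label h := B.isSink_of_label h
  source_tail_mem h := B.source_tail_mem h
  label_cons h := B.label_cons h
  tail_cons h := by simp [B.tail_cons h]
  cons_tail h := by simp [B.cons_tail h]

end BranchingSystem

namespace BoundaryPath

/-- Even the junk value of `cons` shares a tail with `y`, so a tail class is stable under `cons`
without conditions. -/
theorem tail_cons_or (e : E) (y : G.BoundaryPath) : tail (cons e y) = y ∨ cons e y = y := by
  by_cases h : G.labelSource (y.seq 0) ∈ G.range e
  · exact .inl ((system G).tail_cons h)
  · exact .inr (by rw [cons, dif_neg h])

/-- The boundary paths that have a tail in common with `x`. -/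
def TailClass (x : G.BoundaryPath) : Type _ :=
  {y : G.BoundaryPath // ∃ m n, tail^[m] y = tail^[n] x}

/-- The branching system of the boundary paths that have a tail in common with `x`. -/
noncomputable def tailSystem (x : G.BoundaryPath) : G.BranchingSystem x.TailClass where
  label y := (system G).label y.1
  tail y := ⟨tail y.1, by
    obtain ⟨m, n, h⟩ := y.2
    refine ⟨m, n + 1, ?_⟩
    rw [← Function.iterate_succ_apply, Function.iterate_succ_apply', h,
      Function.iterate_succ_apply']⟩
  cons e y := ⟨cons e y.1, by
    obtain ⟨m, n, h⟩ := y.2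
    obtain h' | h' := tail_cons_or e y.1
    · exact ⟨m + 1, n, by rw [Function.iterate_succ_apply, h', h]⟩
    · exact ⟨m, n, by rw [h', h]⟩⟩
  isSink_of_label h := (system G).isSink_of_label h
  source_tail_mem h := (system G).source_tail_mem h
  label_cons h := (system G).label_cons h
  tail_cons h := Subtype.ext ((system G).tail_cons h)
  cons_tail h := Subtype.ext ((system G).cons_tail h)

variable (x : G.BoundaryPath)

theorem tailSystem_tail_iterate (n : ℕ) (y : x.TailClass) :
    ((tailSystem x).tail^[n] y).1 = tail^[n] y.1 := by
  induction n generalizing y with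
  | zero => rfl
  | succ n ih => exact ih _

theorem tailSystem_separated : (tailSystem x).Separated := by
  intro y z h
  refine Subtype.ext (ext_label fun n => ?_)
  rw [← tailSystem_tail_iterate, ← tailSystem_tail_iterate]
  exact h n

theorem tailSystem_tail_of_label (y : x.TailClass) (w : V)
    (h : (tailSystem x).label y = .inl w) : (tailSystem x).tail y = y :=
  Subtype.ext (tail_of_label h)

theorem tailSystem_exists_tail_eq (y z : x.TailClass) :
    ∃ m n, (tailSystem x).tail^[m] y = (tailSystem x).tail^[n] z := by
  obtain ⟨a, b, h⟩ := y.2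
  obtain ⟨c, d, h'⟩ := z.2
  -- Both tails equal `tail^[d + b] x`.
  refine ⟨d + a, b + c, Subtype.ext ?_⟩
  rw [tailSystem_tail_iterate, tailSystem_tail_iterate, Function.iterate_add_apply, h,
    Function.iterate_add_apply, h', ← Function.iterate_add_apply, ← Function.iterate_add_apply,
    add_comm]

instance : Nonempty x.TailClass := ⟨⟨x, 0, 0, rfl⟩⟩

theorem tailSystem_isSimpleAction (K : Type*) [Field K] :
    IsSimpleAction ((tailSystem x).action K) :=
  BranchingSystem.isSimpleAction_action (tailSystem_separated x) (tailSystem_tail_of_label x)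
    (tailSystem_exists_tail_eq x)

/-- If every vertex reaches a vertex on `x`, then every vertex is the source of a boundary path
that has a tail in common with `x`. -/
theorem exists_tailClass_src_eq (hx : ∀ v, ∃ n, G.Reaches v ((system G).src (tail^[n] x)))
    (v : V) : ∃ y, (tailSystem x).src y = v := by
  obtain ⟨n, hn⟩ := hx v
  rw [reaches_iff_reflTransGen] at hn
  induction hn using Relation.ReflTransGen.head_induction_on with
  | refl => exact ⟨⟨tail^[n] x, 0, n, rfl⟩, rfl⟩
  | head h _ ih =>
    obtain ⟨e, rfl, he⟩ := h
    obtain ⟨y, rfl⟩ := ih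
    exact ⟨(tailSystem x).cons e y, BranchingSystem.src_cons he⟩

end BoundaryPath

end Ultragraph

/-! ### Periods of points, and aperiodicity from exits -/

namespace Ultragraph

variable {V E : Type*} {G : Ultragraph V E}

namespace BranchingSystem

variable {Y : Type*} (B : G.BranchingSystem Y)

/-- The point with the reverse of the list of edges put in front. -/
def prepend : List E → Y → Y
  | [], z => z
  | e :: g, z => prepend g (B.cons e z)

variable {B}

theorem tail_iterate_prepend {g : List E} {z : Y} (h : G.ReversePath g (B.src z)) :
    B.tail^[g.length] (B.prepend g z) = z := by
  induction g generalizing z with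
  | nil => rfl
  | cons e g ih =>
    rw [List.length_cons, Function.iterate_succ_apply', prepend, ih, B.tail_cons h.1]
    rw [src_cons h.1]
    exact h.2

theorem label_tail_iterate_prepend {g : List E} {z : Y} (h : G.ReversePath g (B.src z)) (n : ℕ)
    (hn : n < g.reverse.length) :
    B.label (B.tail^[n] (B.prepend g z)) = .inr g.reverse[n] := by
  induction g generalizing z with
  | nil => simp at hn
  | cons e g ih =>
    have h' : G.ReversePath g (B.src (B.cons e z)) := by
      rw [src_cons h.1]
      exact h.2
    simp only [List.reverse_cons]
    rw [List.getElem_append]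
    split_ifs with hg
    · exact ih h' hg
    · have : n = g.length := by simp at hn hg; omega
      subst this
      rw [prepend, tail_iterate_prepend h', B.label_cons h.1]
      simp

theorem prepend_append (g h : List E) (z : Y) :
    B.prepend (g ++ h) z = B.prepend h (B.prepend g z) := by
  induction g generalizing z with
  | nil => rfl
  | cons e g ih => exact ih _

theorem reversePath_append {g h : List E} {z : Y} (hg : G.ReversePath (g ++ h) (B.src z)) :
    G.ReversePath g (B.src z) ∧ G.ReversePath h (B.src (B.prepend g z)) := by
  induction g generalizing z with
  | nil => exact ⟨trivial, hg⟩
  | cons e g ih =>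
    obtain ⟨h₁, h₂⟩ := hg
    have := ih (z := B.cons e z) (by rwa [src_cons h₁])
    rw [src_cons h₁] at this
    exact ⟨⟨h₁, this.1⟩, this.2⟩

theorem eq_of_prepend_eq {g h : List E} {z z' : Y} (hg : G.ReversePath g (B.src z))
    (hh : G.ReversePath h (B.src z')) (hlen : g.length = h.length)
    (heq : B.prepend g z = B.prepend h z') : g = h := by
  refine List.reverse_injective (List.ext_getElem (by simpa) fun n h₁ h₂ => ?_)
  have := label_tail_iterate_prepend hg n h₁
  rw [heq, label_tail_iterate_prepend hh n h₂] at this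
  exact (Sum.inr_injective this).symm

/-- Remove the first `g.length` edges on both sides. Lists are prepended in reverse, so the initial
segment of `h` is the part next to `z`; what remains says that this segment is a period of `z`. -/
theorem eq_or_prepend_take_eq {g h : List E} {z : Y} (hg : G.ReversePath g (B.src z))
    (hh : G.ReversePath h (B.src z)) (hlen : g.length ≤ h.length)
    (heq : B.prepend g z = B.prepend h z) : g = h ∨
      (h.take (h.length - g.length) ≠ [] ∧
        G.ReversePath (h.take (h.length - g.length)) (B.src z) ∧
        B.prepend (h.take (h.length - g.length)) z = z) := by
  obtain hl | hl := hlen.eq_or_lt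
  · exact .inl (eq_of_prepend_eq hg hh hl heq)
  · right
    have hdrop : (h.drop (h.length - g.length)).length = g.length := by
      rw [List.length_drop]; omega
    rw [← List.take_append_drop (h.length - g.length) h] at hh heq
    obtain ⟨h₁, h₂⟩ := reversePath_append hh
    refine ⟨?_, h₁, ?_⟩
    · rw [← List.length_pos_iff, List.length_take]
      omega
    · rw [prepend_append] at heq
      have h₃ := tail_iterate_prepend h₂
      rw [← heq, hdrop, tail_iterate_prepend hg] at h₃
      exact h₃.symm

/-- A point fixed by prepending `g` repeats the reverse of `g` for ever, so `g` determines all its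
labels. -/
theorem subsingleton_prepend_eq (hB : B.Separated) {g : List E} (hg : g ≠ []) {y z : Y}
    (hy : G.ReversePath g (B.src y)) (hz : G.ReversePath g (B.src z))
    (hgy : B.prepend g y = y) (hgz : B.prepend g z = z) : y = z := by
  have h₁ := tail_iterate_prepend hy
  have h₂ := tail_iterate_prepend hz
  rw [hgy] at h₁
  rw [hgz] at h₂
  refine hB y z fun n => ?_
  induction n using Nat.strong_induction_on with
  | _ n ih =>
    by_cases hn : n < g.reverse.length
    · have h₃ := label_tail_iterate_prepend hy n hn
      have h₄ := label_tail_iterate_prepend hz n hn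
      rw [hgy] at h₃
      rw [hgz] at h₄
      exact h₃.trans h₄.symm
    · rw [List.length_reverse, not_lt] at hn
      have := ih (n - g.length) (by have := List.length_pos_iff.2 hg; omega)
      rw [← Nat.sub_add_cancel hn, Function.iterate_add_apply, Function.iterate_add_apply, h₁,
        h₂]
      exact this

variable (B) in
/-- No finite set of lists of edges contains, for each point with a given source, a period of the
point. -/
def Aperiodic : Prop := ∀ (v : V) (Γ : Finset (List E)), ∃ z, B.src z = v ∧
  ∀ γ ∈ Γ, γ ≠ [] → G.ReversePath γ v → B.prepend γ z ≠ z

/-- A cycle can be extracted from a sequence of edges that returns to a vertex. -/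
theorem _root_.Ultragraph.exists_isCycle_of_source_eq (e : ℕ → E)
    (he : ∀ n, G.source (e (n + 1)) ∈ G.range (e n)) {k : ℕ} (hk : 0 < k)
    (hek : G.source (e k) = G.source (e 0)) : ∃ i N, 0 < N ∧
      G.source (e (i + N)) = G.source (e i) ∧
      G.IsCycle ((List.range N).map fun k => e (i + k)) := by
  classical
  -- The shortest return, over all starting indices, has pairwise distinct sources: a repetition
  -- would be a shorter return.
  have hex : ∃ N, 0 < N ∧ ∃ i, G.source (e (i + N)) = G.source (e i) :=
    ⟨k, hk, 0, by rwa [zero_add]⟩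
  obtain ⟨hN, i, hi⟩ := Nat.find_spec hex
  have hmin := fun m => Nat.find_min hex (m := m)
  generalize Nat.find hex = N at hN hi hmin
  have hne : ((List.range N).map fun k => e (i + k)) ≠ [] := by
    rw [← List.length_pos_iff]; simpa
  refine ⟨i, N, hN, hi, ⟨hne, ?_⟩, ⟨hne, ?_⟩, ?_⟩
  · rw [List.isChain_iff_getElem]
    intro n hn
    simp only [List.getElem_map, List.getElem_range]
    exact he (i + n)
  · rw [List.head_eq_getElem, List.getLast_eq_getElem]
    simp only [List.getElem_map, List.getElem_range, List.length_map, List.length_range]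
    rw [add_zero, ← hi]
    convert he (i + (N - 1)) using 3
    omega
  · rw [List.map_map]
    refine (List.nodup_map_iff_inj_on List.nodup_range).2 ?_
    have key : ∀ a b, a < b → b < N → G.source (e (i + a)) ≠ G.source (e (i + b)) := by
      intro a b hab hb h
      refine hmin (b - a) (by omega) ⟨by omega, i + a, ?_⟩
      rw [h]
      congr 2
      omega
    intro a ha b hb h
    rw [List.mem_range] at ha hb
    obtain h' | h' | h' := lt_trichotomy a b
    · exact absurd h (key a b h' hb)
    · exact h'
    · exact absurd h.symm (key b a h' ha)

/-- Suppose that every point over `v` has a period in `Γ`. A list is the period of at most one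
point, so only finitely many points lie over `v`, and one of them runs through a closed path `e 0, e
1, …`. Prepending `e n` injects the points over the source of `e (n + 1)` into those over the source
of `e n`. The numbers of these points are finite, nonincreasing and periodic in `n`, hence constant,
and the injections are bijections. So every point with source in the range of `e n` begins with `e
(n + 1)`. As every vertex is the source of a point, a cycle inside the closed path has no exit. -/
theorem aperiodic_of_hasExit (hB : B.Separated)
    (hsink : ∀ y w, B.label y = .inl w → B.tail y = y) (hsrc : ∀ v, ∃ y, B.src y = v)
    (hL : ∀ α : List E, G.IsCycle α → G.HasExit α) : B.Aperiodic := by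
  classical
  intro v Γ
  by_contra! hper
  have hfin : {z | B.src z = v}.Finite := by
    refine (Γ.finite_toSet.biUnion (t := fun γ =>
      {z | γ ≠ [] ∧ G.ReversePath γ (B.src z) ∧ B.prepend γ z = z}) ?_).subset ?_
    · rintro γ -
      refine Set.Subsingleton.finite ?_
      rintro y ⟨h, hy, hy'⟩ z ⟨-, hz, hz'⟩
      exact subsingleton_prepend_eq hB h hy hz hy' hz'
    · intro z hz
      obtain ⟨γ, hγ, h₁, h₂, h₃⟩ := hper z hz
      exact Set.mem_biUnion hγ ⟨h₁, by rwa [hz], h₃⟩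
  obtain ⟨z, hz⟩ := hsrc v
  obtain ⟨γ, -, hγ, hγv, hγz⟩ := hper z hz
  rw [← hz] at hγv
  have hpos : 0 < γ.length := List.length_pos_iff.2 hγ
  have hper' : B.tail^[γ.length] z = z := by
    have := tail_iterate_prepend hγv
    rwa [hγz] at this
  -- A sink label is stationary under `tail`, so by periodicity `z` itself would carry it, although
  -- `z` begins with an edge.
  have hedge : ∀ n, ∃ e, B.label (B.tail^[n] z) = .inr e := by
    intro n
    match h : B.label (B.tail^[n] z) with
    | .inr e => exact ⟨e, rfl⟩
    | .inl w =>
      have h₁ : B.tail^[γ.length * n] z = z := by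
        rw [Function.iterate_mul]
        exact Function.iterate_fixed hper' n
      have h₂ : B.tail^[γ.length * n - n] (B.tail^[n] z) = B.tail^[n] z :=
        Function.iterate_fixed (hsink _ w h) _
      rw [← Function.iterate_add_apply, Nat.sub_add_cancel (Nat.le_mul_of_pos_left n hpos),
        h₁] at h₂
      rw [← h₂] at h
      have h₃ := label_tail_iterate_prepend hγv 0 (by simpa)
      rw [hγz, Function.iterate_zero_apply, h] at h₃
      cases h₃
  choose e he using hedge
  have hstep : ∀ n, G.source (e (n + 1)) ∈ G.range (e n) := by
    intro n
    have := src_tail_mem (he n)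
    rwa [← Function.iterate_succ_apply' B.tail, src_of_label (he (n + 1))] at this
  have heper : ∀ n, e (n + γ.length) = e n := by
    intro n
    refine Sum.inr_injective ((he _).symm.trans (Eq.trans ?_ (he n)))
    rw [Function.iterate_add_apply, hper']
  have hsub : ∀ n, B.cons (e n) '' {y | B.src y = G.source (e (n + 1))} ⊆
      {y | B.src y = G.source (e n)} := by
    rintro n _ ⟨y, hy, rfl⟩
    exact src_cons (by rw [hy]; exact hstep n)
  have hinj : ∀ n, Set.InjOn (B.cons (e n)) {y | B.src y = G.source (e (n + 1))} := by
    intro n y hy y' hy' h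
    have hs := hstep n
    rw [← B.tail_cons (e := e n) (y := y) (by rw [← hy] at hs; exact hs), h,
      B.tail_cons (by rw [← hy'] at hs; exact hs)]
  have hfin' : ∀ n, {y | B.src y = G.source (e n)}.Finite := by
    intro n
    induction n with
    | zero => rwa [← src_of_label (he 0), Function.iterate_zero_apply, hz]
    | succ n ih => exact (ih.subset (hsub n)).of_finite_image (hinj n)
  have hanti : Antitone fun n => {y | B.src y = G.source (e n)}.ncard := by
    refine antitone_nat_of_succ_le fun n => ?_
    rw [← (hinj n).ncard_image]
    exact Set.ncard_le_ncard (hsub n) (hfin' n)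
  have himage : ∀ n, B.cons (e n) '' {y | B.src y = G.source (e (n + 1))} =
      {y | B.src y = G.source (e n)} := by
    intro n
    refine Set.eq_of_subset_of_ncard_le (hsub n) ?_ (hfin' n)
    rw [(hinj n).ncard_image, ← heper n]
    exact hanti (by omega : n + 1 ≤ n + γ.length)
  have hlabel : ∀ n y, B.src y = G.source (e n) →
      B.label y = .inr (e n) ∧ B.src (B.tail y) = G.source (e (n + 1)) := by
    intro n y hy
    obtain ⟨y', hy', rfl⟩ := (himage n).ge hy
    have hs : B.src y' ∈ G.range (e n) := by
      rw [hy']; exact hstep n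
    rw [B.tail_cons hs]
    exact ⟨B.label_cons hs, hy'⟩
  -- Putting `e n` in front of `y` gives a point over the source of `e n`, and the bijection
  -- determines the source of its tail, which is `y`.
  have hnext : ∀ n y, B.src y ∈ G.range (e n) → B.label y = .inr (e (n + 1)) := by
    intro n y hy
    refine (hlabel (n + 1) y ?_).1
    have := (hlabel n (B.cons (e n) y) (src_cons hy)).2
    rwa [B.tail_cons hy] at this
  obtain ⟨i, N, hN, hi, hcyc⟩ := exists_isCycle_of_source_eq e hstep hpos
    (by rw [← zero_add γ.length, heper])
  obtain ⟨f, j, hf, hne⟩ | ⟨w, j, hw, hwj⟩ := hL _ hcyc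
  · simp only [List.get_eq_getElem, List.getElem_map, List.getElem_range, List.length_map,
      List.length_range] at hf hne
    obtain ⟨u, hu⟩ := G.range_nonempty f
    obtain ⟨y, rfl⟩ := hsrc u
    have h₁ := hnext (i + j) (B.cons f y) (by rwa [src_cons hu])
    rw [B.label_cons hu] at h₁
    refine hne ((Sum.inr_injective h₁).trans ?_)
    have hj : (j : ℕ) < N := by simpa using j.2
    by_cases hj' : (j : ℕ) + 1 < N
    · rw [Nat.mod_eq_of_lt hj', add_assoc]
    -- At the last index the cycle wraps around to `e i`; this is `e (i + N)`, since the two sources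
    -- agree and the source determines the label.
    · have hj'' : (j : ℕ) + 1 = N := by omega
      rw [add_assoc, hj'', Nat.mod_self, add_zero]
      have h₂ := he i
      rw [(hlabel (i + N) _ (by rw [src_of_label (he i), hi])).1] at h₂
      exact Sum.inr_injective h₂
  · simp only [List.get_eq_getElem, List.getElem_map, List.getElem_range] at hwj
    obtain ⟨y, rfl⟩ := hsrc w
    have h₁ := hnext (i + j) y hwj
    exact hw _ (src_of_label h₁).symm

end BranchingSystem

end Ultragraph

/-! ### Faithfulness of aperiodic branching systems -/

namespace Ultragraph

variable {V E : Type*} {G : Ultragraph V E}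

namespace LeavittPathAlgebra

variable {K : Type*} [Field K]

theorem exists_eq_sum_ghostWord {b : G.LeavittPathAlgebra K} (hb : b ∈ ghostSpan G K) :
    ∃ (T : Finset ({A : Set V // G.IsGenVertex A} × List E))
      (k : {A : Set V // G.IsGenVertex A} × List E → K),
      b = ∑ i ∈ T, k i • ghostWord G K i.1.1 i.2 := by
  have hrange : {x | ∃ A g, G.IsGenVertex A ∧ x = ghostWord G K A g} =
      Set.range fun i : {A : Set V // G.IsGenVertex A} × List E =>
        ghostWord G K i.1.1 i.2 := by
    ext x
    constructor
    · rintro ⟨A, g, hA, rfl⟩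
      exact ⟨(⟨A, hA⟩, g), rfl⟩
    · rintro ⟨⟨⟨A, hA⟩, g⟩, rfl⟩
      exact ⟨A, g, hA, rfl⟩
  rw [ghostSpan, hrange, Finsupp.mem_span_range_iff_exists_finsupp] at hb
  obtain ⟨c, rfl⟩ := hb
  exact ⟨c.support, c, rfl⟩

theorem exists_eq_add_sum {n : ℕ} {a : G.LeavittPathAlgebra K} (ha : a ∈ filt G K (n + 1)) :
    ∃ b ∈ ghostSpan G K, ∃ (F : Finset E) (c : E → G.LeavittPathAlgebra K),
      (∀ e, c e ∈ filt G K n) ∧ a = b + ∑ e ∈ F, s G K e * c e := by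
  obtain ⟨b, hb, d, hd, rfl⟩ := Submodule.mem_sup.1 ha
  obtain ⟨f, hf, rfl⟩ := (Submodule.mem_iSup_iff_exists_finsupp _ _).1 hd
  choose c hc hc' using fun e => Submodule.mem_map.1 (hf e)
  refine ⟨b, hb, f.support, c, hc, ?_⟩
  congr 1
  exact Finset.sum_congr rfl fun e _ => (hc' e).symm

variable {ι : Type*}

open Classical in
/-- The coefficient of a combination of ghost words at a list of edges and a vertex. -/
noncomputable def coeff (T : Finset ι) (A : ι → Set V) (w : ι → List E) (k : ι → K) (g : List E)
    (v : V) : K :=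
  ∑ i ∈ T, if w i = g ∧ v ∈ A i then k i else 0

theorem sum_eq_zero_of_coeff {T : Finset ι} {A : ι → Set V} (hA : ∀ i ∈ T, G.IsGenVertex (A i))
    {w : ι → List E} {k : ι → K} (h : ∀ g v, G.ReversePath g v → coeff T A w k g v = 0) :
    ∑ i ∈ T, k i • ghostWord G K (A i) (w i) = 0 := by
  classical
  rw [← Finset.sum_fiberwise_of_maps_to (t := T.image w) (g := w)
    fun i hi => Finset.mem_image_of_mem w hi]
  refine Finset.sum_eq_zero fun g _ => ?_
  have : ∀ i ∈ T.filter (w · = g), k i • ghostWord G K (A i) (w i) =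
      k i • ghostWord G K (A i) g := by
    intro i hi
    rw [(Finset.mem_filter.1 hi).2]
  rw [Finset.sum_congr rfl this]
  refine sum_ghostWord_eq_zero g _ A k (fun i hi => hA i (Finset.mem_filter.1 hi).1) ?_
  intro v hg
  refine Eq.trans ?_ (h g v hg)
  rw [coeff, Finset.sum_filter]
  exact Finset.sum_congr rfl fun i _ => (ite_and _ _ _ _).symm

end LeavittPathAlgebra

namespace BranchingSystem

open LeavittPathAlgebra

variable {Y : Type*} (B : G.BranchingSystem Y) {K : Type*} [Field K]

open Classical in
theorem rep_p_apply {A : Set V} (hA : G.IsGenVertex A) (m : Y →₀ K) (z : Y) :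
    B.rep K (p G K A) m z = if B.src z ∈ A then m z else 0 := by
  induction m using Finsupp.induction_linear with
  | zero => simp
  | add m m' h h' => rw [map_add, Finsupp.add_apply, h, h', Finsupp.add_apply]; split_ifs <;> simp
  | single y k =>
    rw [rep_single, rep_p B hA]
    by_cases hyz : y = z
    · subst hyz
      split_ifs <;> simp
    · rw [Finsupp.single_eq_of_ne (Ne.symm hyz)]
      split_ifs <;> simp [Finsupp.single_eq_of_ne (Ne.symm hyz)]

open Classical in
theorem rep_s_apply (e : E) (m : Y →₀ K) (z : Y) :
    B.rep K (s G K e) m z = if B.label z = .inr e then m (B.tail z) else 0 := by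
  induction m using Finsupp.induction_linear with
  | zero => simp
  | add m m' h h' => rw [map_add, Finsupp.add_apply, h, h', Finsupp.add_apply]; split_ifs <;> simp
  | single y k =>
    rw [rep_single, rep_s]
    by_cases hz : B.label z = .inr e
    · rw [if_pos hz]
      by_cases hyz : B.tail z = y
      · subst hyz
        rw [if_pos (src_tail_mem hz), B.cons_tail hz]
        simp
      · rw [Finsupp.single_eq_of_ne hyz]
        split_ifs with hy
        · have : z ≠ B.cons e y := by
            rintro rfl
            exact hyz (B.tail_cons hy)
          simp [Finsupp.single_eq_of_ne this]
        · simp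
    · rw [if_neg hz]
      split_ifs with hy
      · have : z ≠ B.cons e y := by
          rintro rfl
          exact hz (B.label_cons hy)
        simp [Finsupp.single_eq_of_ne this]
      · simp

open Classical in
theorem rep_t_apply (e : E) (m : Y →₀ K) (z : Y) :
    B.rep K (t G K e) m z = if B.src z ∈ G.range e then m (B.cons e z) else 0 := by
  induction m using Finsupp.induction_linear with
  | zero => simp
  | add m m' h h' => rw [map_add, Finsupp.add_apply, h, h', Finsupp.add_apply]; split_ifs <;> simp
  | single y k =>
    rw [rep_single, rep_t]
    by_cases hz : B.src z ∈ G.range e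
    · rw [if_pos hz]
      by_cases hyz : y = B.cons e z
      · subst hyz
        rw [if_pos (B.label_cons hz), B.tail_cons hz]
        simp
      · rw [Finsupp.single_eq_of_ne (Ne.symm hyz)]
        split_ifs with hy
        · have : z ≠ B.tail y := by
            rintro rfl
            exact hyz (B.cons_tail hy).symm
          simp [Finsupp.single_eq_of_ne this]
        · simp
    · rw [if_neg hz]
      split_ifs with hy
      · have : z ≠ B.tail y := by
          rintro rfl
          exact hz (src_tail_mem hy)
        simp [Finsupp.single_eq_of_ne this]
      · simp

open Classical in
theorem rep_ghostWord_apply (g : List E) {A : Set V} (hA : G.IsGenVertex A) (y z : Y) :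
    B.rep K (ghostWord G K A g) (Finsupp.single y 1) z =
      if G.ReversePath g (B.src z) ∧ B.src z ∈ A ∧ B.prepend g z = y then 1 else 0 := by
  induction g generalizing A z with
  | nil =>
    rw [ghostWord, rep_p_apply B hA, Finsupp.single_apply]
    simp only [ReversePath, prepend, true_and, ite_and, eq_comm]
  | cons e g ih =>
    rw [ghostWord, map_mul, map_mul, Module.End.mul_apply, Module.End.mul_apply,
      rep_p_apply B hA, rep_t_apply]
    by_cases h₁ : B.src z ∈ A
    · by_cases h₂ : B.src z ∈ G.range e
      · rw [if_pos h₁, if_pos h₂, ih (.singleton _), src_cons h₂]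
        simp [ReversePath, prepend, h₁, h₂]
      · rw [if_pos h₁, if_neg h₂, if_neg]
        exact fun h => h₂ h.1.1
    · rw [if_neg h₁, if_neg]
      exact fun h => h₁ h.2.1

variable {B}

/-- Apply the combination to the basis vector of `B.prepend g z` and read the coordinate at `z`. A
word `w i` contributes only if it is `g` or if its excess over `g`, or that of `g` over it, is a
period of `z`; a suitable `z` excludes the latter for the finitely many words at once. -/
theorem coeff_eq_zero (hB : B.Aperiodic) {ι : Type*} {T : Finset ι} {A : ι → Set V}
    (hA : ∀ i ∈ T, G.IsGenVertex (A i)) {w : ι → List E} {k : ι → K}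
    (h : B.rep K (∑ i ∈ T, k i • ghostWord G K (A i) (w i)) = 0) {g : List E} {v : V}
    (hg : G.ReversePath g v) : coeff T A w k g v = 0 := by
  classical
  obtain ⟨z, rfl, hz⟩ := hB v
    ((T.image fun i => (w i).take ((w i).length - g.length)) ∪
      T.image fun i => g.take (g.length - (w i).length))
  have h₁ := DFunLike.congr_fun (LinearMap.congr_fun h (Finsupp.single (B.prepend g z) 1)) z
  rw [map_sum, LinearMap.sum_apply, Finsupp.finsetSum_apply] at h₁
  refine Eq.trans (Finset.sum_congr rfl fun i hi => ?_) h₁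
  rw [rep_smul, LinearMap.smul_apply, Finsupp.smul_apply, rep_ghostWord_apply B _ (hA i hi),
    smul_eq_mul, mul_ite, mul_one, mul_zero]
  refine if_congr ⟨?_, ?_⟩ rfl rfl
  · rintro ⟨rfl, hv⟩
    exact ⟨hg, hv, rfl⟩
  · rintro ⟨hw, hv, heq⟩
    refine ⟨?_, hv⟩
    obtain hle | hle := le_total (w i).length g.length
    · obtain h' | ⟨h₂, h₃, h₄⟩ := eq_or_prepend_take_eq hw hg hle heq
      · exact h'
      · exact absurd h₄ (hz _ (Finset.mem_union_right _ (Finset.mem_image_of_mem _ hi)) h₂ h₃)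
    · obtain h' | ⟨h₂, h₃, h₄⟩ := eq_or_prepend_take_eq hg hw hle heq.symm
      · exact h'.symm
      · exact absurd h₄ (hz _ (Finset.mem_union_left _ (Finset.mem_image_of_mem _ hi)) h₂ h₃)

theorem eq_zero_of_mem_ghostSpan (hB : B.Aperiodic) {b : G.LeavittPathAlgebra K}
    (hb : b ∈ ghostSpan G K) (h : B.rep K b = 0) : b = 0 := by
  obtain ⟨T, k, rfl⟩ := exists_eq_sum_ghostWord hb
  exact sum_eq_zero_of_coeff (fun i _ => i.1.2) fun g v hg =>
    coeff_eq_zero hB (fun i _ => i.1.2) h hg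

/-- Ghost edges cancel on ghost words: adding `f` to every word with `source f` in its vertex set
does not change the coefficients, and those of `s_f^* b` vanish by aperiodicity. -/
theorem p_mul_eq_zero_of_t_mul (hB : B.Aperiodic) {b : G.LeavittPathAlgebra K}
    (hb : b ∈ ghostSpan G K) {f : E} (h : t G K f * b = 0) : p G K {G.source f} * b = 0 := by
  classical
  obtain ⟨T, k, rfl⟩ := exists_eq_sum_ghostWord hb
  have h₁ : t G K f * ∑ i ∈ T, k i • ghostWord G K i.1.1 i.2 =
      ∑ i ∈ T.filter (G.source f ∈ ·.1.1), k i • ghostWord G K (G.range f) (f :: i.2) := by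
    rw [Finset.mul_sum, Finset.sum_filter]
    refine Finset.sum_congr rfl fun i _ => ?_
    rw [mul_smul_comm]
    split_ifs with hi
    · rw [t_mul_ghostWord i.1.2 hi]
    · rw [t_mul_ghostWord_of_notMem i.1.2 hi, smul_zero]
  have h₂ : p G K {G.source f} * ∑ i ∈ T, k i • ghostWord G K i.1.1 i.2 =
      ∑ i ∈ T.filter (G.source f ∈ ·.1.1), k i • ghostWord G K {G.source f} i.2 := by
    rw [Finset.mul_sum, Finset.sum_filter]
    refine Finset.sum_congr rfl fun i _ => ?_
    rw [mul_smul_comm, p_mul_ghostWord (.singleton _) i.1.2]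
    split_ifs with hi
    · rw [Set.inter_eq_left.2 (by simpa)]
    · rw [Set.singleton_inter_eq_empty.2 hi, ghostWord_eq_zero _ .empty (by simp), smul_zero]
  obtain ⟨u, hu⟩ := G.range_nonempty f
  rw [h₂]
  refine sum_eq_zero_of_coeff (fun _ _ => .singleton _) fun g v hg => ?_
  by_cases hv : v = G.source f
  · subst hv
    have h₃ := coeff_eq_zero hB (T := T.filter (G.source f ∈ ·.1.1))
      (A := fun _ => G.range f) (w := fun i => f :: i.2) (k := k) (fun _ _ => .range f)
      (by rw [← h₁, h, map_zero]) (g := f :: g) (v := u) ⟨hu, hg⟩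
    rw [← h₃, coeff, coeff]
    refine Finset.sum_congr rfl fun i _ => ?_
    simp [hu]
  · rw [coeff]
    refine Finset.sum_eq_zero fun i _ => if_neg fun h => hv h.2

/-- Each `s_e^* a` has lower degree and acts as zero, so it is zero. Hence `a = b - ∑ s_e s_e^* b`
with `b` a combination of ghost words. Let `q` be the sum of the projections at the sources of the
edges in the sum. Then `q a = 0`, while `q` fixes those `s_e`; so the sum equals `q b`, and `a = b -
q b` is again a combination of ghost words. -/
theorem eq_zero_of_mem_filt (hB : B.Aperiodic) (n : ℕ) {a : G.LeavittPathAlgebra K}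
    (ha : a ∈ filt G K n) (h : B.rep K a = 0) : a = 0 := by
  classical
  induction n generalizing a with
  | zero => exact eq_zero_of_mem_ghostSpan hB ha h
  | succ n ih =>
    have hta : ∀ e, t G K e * a = 0 := fun e =>
      ih (t_mul_mem_filt e ha) (by rw [map_mul, h, mul_zero])
    obtain ⟨b, hb, F, c, -, hac⟩ := exists_eq_add_sum ha
    have htb : ∀ f ∉ F, t G K f * b = 0 := by
      intro f hf
      have := hta f
      rw [hac, mul_add, Finset.mul_sum, Finset.sum_eq_zero, add_zero] at this
      · exact this
      · intro e he
        rw [← mul_assoc, t_mul_s_of_ne, zero_mul]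
        rintro rfl
        exact hf he
    have hsc : ∀ e ∈ F, s G K e * c e = -(s G K e * (t G K e * b)) := by
      intro e he
      have := hta e
      rw [hac, mul_add, Finset.mul_sum, Finset.sum_eq_single e] at this
      · rw [eq_neg_iff_add_eq_zero, add_comm, ← mul_zero (s G K e), ← this, mul_add,
          ← mul_assoc (t G K e), t_mul_s, ← mul_assoc (s G K e) (p G K _), s_mul_p_range]
      · intro f _ hf
        rw [← mul_assoc, t_mul_s_of_ne hf.symm, zero_mul]
      · exact fun h => absurd he h
    rw [Finset.sum_congr rfl hsc, Finset.sum_neg_distrib, ← sub_eq_add_neg] at hac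
    -- A source that emits finitely many edges is handled by the fourth relation. One that emits
    -- infinitely many has an edge outside `F`, whose ghost edge kills `b`; cancelling it gives `p_v
    -- b = 0`.
    have hp : ∀ e ∈ F, p G K {G.source e} * a = 0 := by
      intro e he
      by_cases hfin : {f | G.source f = G.source e}.Finite
      · rw [p_regular _ hfin ⟨e, rfl⟩, Finset.sum_mul]
        refine Finset.sum_eq_zero fun f _ => ?_
        rw [mul_assoc, hta, mul_zero]
      · obtain ⟨f, hf, hfF⟩ := Set.Infinite.exists_notMem_finset hfin F
        have hpb := p_mul_eq_zero_of_t_mul hB hb (htb f hfF)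
        rw [show G.source f = G.source e from hf] at hpb
        rw [hac, mul_sub, hpb, zero_sub, neg_eq_zero, Finset.mul_sum]
        refine Finset.sum_eq_zero fun e' _ => ?_
        by_cases hee : G.source e' = G.source e
        · rw [← t_mul_p_source, hee, mul_assoc, hpb, mul_zero, mul_zero, mul_zero]
        · rw [← mul_assoc, p_mul_s_of_notMem (.singleton _) (by simpa), zero_mul]
    set q := ∑ v ∈ F.image G.source, p G K {v} with hq
    have hqa : q * a = 0 := by
      rw [hq, Finset.sum_mul]
      refine Finset.sum_eq_zero fun v hv => ?_
      obtain ⟨e, he, rfl⟩ := Finset.mem_image.1 hv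
      exact hp e he
    have hqs : ∀ e ∈ F, q * s G K e = s G K e := by
      intro e he
      rw [hq, Finset.sum_mul, Finset.sum_eq_single (G.source e), p_source_mul_s]
      · intro v _ hv
        exact p_mul_s_of_notMem (.singleton _) (by simpa using hv.symm)
      · exact fun h => absurd (Finset.mem_image_of_mem _ he) h
    have hab : a = b - q * b := by
      have h₁ : q * a = q * b - ∑ e ∈ F, s G K e * (t G K e * b) := by
        rw [hac, mul_sub, Finset.mul_sum]
        congr 1
        refine Finset.sum_congr rfl fun e he => ?_
        rw [← mul_assoc, hqs e he]
      rw [hqa] at h₁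
      rw [sub_eq_zero.1 h₁.symm, ← hac]
    refine eq_zero_of_mem_ghostSpan hB ?_ h
    rw [hab, hq, Finset.sum_mul]
    exact Submodule.sub_mem _ hb (Submodule.sum_mem _ fun v _ =>
      p_mul_mem_filt (n := 0) (.singleton v) hb)

theorem action_injective (hB : B.Aperiodic) : Function.Injective (B.action K) := by
  rw [injective_iff_map_eq_zero]
  intro a ha
  obtain ⟨n, hn⟩ := exists_mem_filt a
  exact eq_zero_of_mem_filt hB n hn (LinearMap.ext fun m => DFunLike.congr_fun ha m)

end BranchingSystem

end Ultragraph

/-! ### A boundary path that every vertex reaches -/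

namespace Ultragraph

variable {V E : Type*} {G : Ultragraph V E}

variable (G) in
/-- The vertex reaches in the given number of steps a vertex below `t`. -/
def ReachesBelow (t : V) : ℕ → V → Prop
  | 0, v => G.Reaches t v
  | n + 1, v => ∃ e, G.source e = v ∧ ∃ u ∈ G.range e, ReachesBelow t n u

namespace BoundaryPath

/-- In a countable downward directed ultragraph every vertex reaches a vertex on a common boundary
path. -/
theorem exists_forall_reaches [Countable V] [Nonempty V] (hG : G.DownwardDirected) :
    ∃ x : G.BoundaryPath, ∀ v, ∃ n, G.Reaches v ((system G).src (tail^[n] x)) := by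
  classical
  -- Enumerate the vertices by `w`. With target `k` the path takes steps that shorten the distance
  -- `d k` to the vertices below `w k`; once `w k` reaches the current vertex, the target becomes `k
  -- + 1`.
  obtain ⟨w, hw⟩ := exists_surjective_nat V
  have hR : ∀ k v, ∃ n, G.ReachesBelow (w k) n v := by
    intro k v
    obtain ⟨u, hv, hu⟩ := hG v (w k)
    rw [reaches_iff_reflTransGen] at hv
    induction hv using Relation.ReflTransGen.head_induction_on with
    | refl => exact ⟨0, hu⟩
    | head h _ ih =>
      obtain ⟨e, he, hb⟩ := h
      obtain ⟨n, hn⟩ := ih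
      exact ⟨n + 1, e, he, _, hb, hn⟩
  let d : ℕ → V → ℕ := fun k v => Nat.find (hR k v)
  have hstep : ∀ k v, ∃ (l : V ⊕ E) (u : V), G.labelSource l = v ∧
      (∀ a, l = .inl a → G.IsSink v ∧ u = v) ∧ (∀ e, l = .inr e → u ∈ G.range e) ∧
      (¬ G.Reaches (w k) v → d k u < d k v) := by
    intro k v
    by_cases h : G.Reaches (w k) v
    · refine ⟨vertexLabel G v, nextVertex G v, labelSource_vertexLabel v, ?_,
        fun e he => nextVertex_mem he, fun h' => absurd h h'⟩
      intro a ha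
      have := (isSink_of_vertexLabel ha).1
      exact ⟨this, nextVertex_of_isSink this⟩
    · obtain ⟨n, hn⟩ : ∃ n, d k v = n + 1 := by
        refine Nat.exists_eq_succ_of_ne_zero fun h0 => h ?_
        have := Nat.find_spec (hR k v)
        rwa [show Nat.find (hR k v) = 0 from h0] at this
      have := Nat.find_spec (hR k v)
      rw [show Nat.find (hR k v) = n + 1 from hn] at this
      obtain ⟨e, rfl, u, hu, hn'⟩ := this
      refine ⟨.inr e, u, rfl, by simp, ?_, fun _ => ?_⟩
      · rintro f hf
        rwa [← Sum.inr_injective hf]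
      · rw [hn, Nat.lt_succ_iff]
        exact Nat.find_min' _ hn'
  choose lab nxt hlab hsink hmem hd using hstep
  -- The state is the current vertex together with the index of the current target.
  let next : V × ℕ → V × ℕ := fun s =>
    (nxt s.2 s.1, if G.Reaches (w s.2) s.1 then s.2 + 1 else s.2)
  obtain ⟨v₀⟩ := ‹Nonempty V›
  let x : G.BoundaryPath := ofStep (fun s : V × ℕ => lab s.2 s.1) next (by
    rintro ⟨v, k⟩
    refine ⟨fun a ha => ?_, fun e he => ?_⟩
    · obtain ⟨h₁, h₂⟩ := hsink k v a ha
      have h₃ := hlab k v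
      rw [show lab k v = .inl a from ha] at h₃
      obtain rfl : a = v := h₃
      refine ⟨h₁, ?_⟩
      have h₄ := hlab (next (a, k)).2 (next (a, k)).1
      have h₅ : (next (a, k)).1 = a := h₂
      rw [h₅] at h₄
      change lab (next (a, k)).2 (next (a, k)).1 = .inl a
      rw [h₅]
      match hl : lab (next (a, k)).2 a with
      | .inl b =>
        rw [hl] at h₄
        exact congrArg Sum.inl h₄
      | .inr e =>
        rw [hl] at h₄
        exact absurd h₄ (h₁ e)
    · rw [hlab]
      exact hmem k v e he) (v₀, 0)
  have hsrc : ∀ n, (system G).src (tail^[n] x) = (next^[n] (v₀, 0)).1 := by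
    intro n
    change G.labelSource ((tail^[n] x).seq 0) = _
    rw [tail_iterate, zero_add]
    exact hlab _ _
  -- The distance to the target decreases strictly until it is met, so no target is pursued for
  -- ever.
  have hprog : ∀ m (s : V × ℕ), d s.2 s.1 ≤ m →
      ∃ n v, next^[n] s = (v, s.2) ∧ G.Reaches (w s.2) v := by
    intro m
    induction m with
    | zero =>
      intro s hs
      refine ⟨0, s.1, rfl, ?_⟩
      by_contra h
      have := hd s.2 s.1 h
      omega
    | succ m ih =>
      intro s hs
      by_cases h : G.Reaches (w s.2) s.1
      · exact ⟨0, s.1, rfl, h⟩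
      · have h₁ : next s = (nxt s.2 s.1, s.2) := Prod.ext rfl (if_neg h)
        have h₂ := hd s.2 s.1 h
        obtain ⟨n, v, hn, hv⟩ := ih (nxt s.2 s.1, s.2) (by dsimp only; omega)
        exact ⟨n + 1, v, by rw [Function.iterate_succ_apply, h₁, hn], hv⟩
  have hall : ∀ k, ∃ n v, next^[n] (v₀, 0) = (v, k) ∧ G.Reaches (w k) v := by
    intro k
    induction k with
    | zero => exact hprog _ (v₀, 0) le_rfl
    | succ k ih =>
      obtain ⟨n, v, hn, hv⟩ := ih
      have h₁ : next (v, k) = (nxt k v, k + 1) := Prod.ext rfl (if_pos hv)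
      obtain ⟨m, u, hm, hu⟩ := hprog _ (nxt k v, k + 1) le_rfl
      refine ⟨m + (n + 1), u, ?_, hu⟩
      rw [Function.iterate_add_apply, Function.iterate_succ_apply', hn, h₁, hm]
  refine ⟨x, fun v => ?_⟩
  obtain ⟨k, rfl⟩ := hw v
  obtain ⟨n, u, hn, hu⟩ := hall k
  exact ⟨n, by rwa [hsrc, hn]⟩

end BoundaryPath

theorem isPrimitiveRing_of_downwardDirected {K : Type*} [Field K] [Countable V] [Nonempty V]
    (hG : G.DownwardDirected) (hL : ∀ α : List E, G.IsCycle α → G.HasExit α) :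
    IsPrimitiveRing (G.LeavittPathAlgebra K) := by
  obtain ⟨x, hx⟩ := BoundaryPath.exists_forall_reaches hG
  exact ⟨x.TailClass →₀ K, inferInstance, x.tailSystem.action K,
    BoundaryPath.tailSystem_isSimpleAction x K,
    BranchingSystem.action_injective (BranchingSystem.aperiodic_of_hasExit
      (BoundaryPath.tailSystem_separated x) (BoundaryPath.tailSystem_tail_of_label x)
      (BoundaryPath.exists_tailClass_src_eq x hx) hL)⟩

end Ultragraph

/-! ### Downward directedness from a faithful simple module -/

theorem IsSimpleAction.exists_apply_eq {R M : Type*} [NonUnitalRing R] [AddCommGroup M]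
    {ρ : R →ₙ+* AddMonoid.End M} (h : IsSimpleAction ρ) {m : M} (hm : m ≠ 0) (m' : M) :
    ∃ r, ρ r m = m' := by
  obtain ⟨⟨r₀, m₀, h₀⟩, hN⟩ := h
  -- The vectors killed by all of `R` form a submodule, which is zero because `R M ≠ 0`.
  let N₀ : AddSubgroup M :=
    { carrier := {m | ∀ r, ρ r m = 0}
      zero_mem' := fun r => map_zero _
      add_mem' := fun {a b} ha hb r => by rw [map_add, ha, hb, add_zero]
      neg_mem' := fun {a} ha r => by rw [map_neg, ha, neg_zero] }
  have h₁ : N₀ = ⊥ := by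
    refine (hN N₀ fun r m hm r' => ?_).resolve_right fun h => ?_
    · rw [hm r, map_zero]
    · have : m₀ ∈ N₀ := h ▸ AddSubgroup.mem_top m₀
      exact h₀ (this r₀)
  -- The submodule `R m` is nonzero, since otherwise `m` would lie in `N₀`.
  let N : AddSubgroup M :=
    { carrier := {m' | ∃ r, ρ r m = m'}
      zero_mem' := ⟨0, by rw [map_zero]; rfl⟩
      add_mem' := by
        rintro _ _ ⟨r, rfl⟩ ⟨r', rfl⟩
        exact ⟨r + r', by rw [map_add]; rfl⟩
      neg_mem' := by
        rintro _ ⟨r, rfl⟩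
        exact ⟨-r, by rw [map_neg]; rfl⟩ }
  have h₂ : N = ⊤ := by
    refine (hN N ?_).resolve_left fun h => hm ?_
    · rintro r _ ⟨r', rfl⟩
      exact ⟨r * r', by rw [map_mul]; rfl⟩
    · have : m ∈ N₀ := fun r => by
        have : ρ r m ∈ N := ⟨r, rfl⟩
        rwa [h, AddSubgroup.mem_bot] at this
      rwa [h₁, AddSubgroup.mem_bot] at this
  have : m' ∈ N := h₂ ▸ AddSubgroup.mem_top m'
  exact this

namespace Ultragraph

variable {V E : Type*} {G : Ultragraph V E} {K : Type*} [Field K]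

open LeavittPathAlgebra

namespace LeavittPathAlgebra

theorem p_singleton_ne_zero (v : V) : p G K {v} ≠ 0 := by
  classical
  intro h
  obtain ⟨y, rfl⟩ := BoundaryPath.exists_src_eq (G := G) v
  have := (BoundaryPath.system G).rep_p (K := K) (.singleton ((BoundaryPath.system G).src y)) y
  rw [h, map_zero, if_pos (Set.mem_singleton _), LinearMap.zero_apply] at this
  simpa using this.symm

/-- Read from right to left, a nonzero product would spell a path from `w` to a vertex of `A`. -/
theorem ghostWord_mul_p_singleton (g : List E) {A : Set V} (hA : G.IsGenVertex A) {w : V}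
    (h : ∀ a ∈ A, ¬ G.Reaches w a) : ghostWord G K A g * p G K {w} = 0 := by
  induction g generalizing A with
  | nil => exact p_mul_p_singleton_of_notMem hA fun hw => h w hw (.inl rfl)
  | cons e g ih =>
    rw [ghostWord]
    by_cases he : G.Reaches w (G.source e)
    · rw [← p_range_mul_t, mul_assoc (p G K (G.range e)), ← mul_assoc (p G K A),
        p_mul_p hA (.range e)]
      have : A ∩ G.range e = ∅ := Set.eq_empty_of_forall_notMem fun a ha => by
        refine h a ha.1 ?_
        rw [reaches_iff_reflTransGen] at he ⊢
        exact he.tail ⟨e, rfl, ha.2⟩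
      rw [this, p_empty, zero_mul, zero_mul]
    · rw [mul_assoc, mul_assoc, ih (.singleton _) (by simpa using he), mul_zero, mul_zero]

/-- In a nonzero term the edges would lead down from `A` and the ghost edges down from `w` to one
common vertex. -/
theorem p_mul_mul_p_singleton {w : V} (x : G.LeavittPathAlgebra K) {A : Set V}
    (hA : G.IsGenVertex A) (h : ∀ a ∈ A, ∀ u, G.Reaches a u → ¬ G.Reaches w u) :
    p G K A * x * p G K {w} = 0 := by
  obtain ⟨n, hn⟩ := exists_mem_filt x
  have h0 : ∀ x ∈ ghostSpan G K, ∀ A, G.IsGenVertex A →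
      (∀ a ∈ A, ∀ u, G.Reaches a u → ¬ G.Reaches w u) → p G K A * x * p G K {w} = 0 := by
    intro x hx A hA h
    refine ghostSpan_induction (C := fun x => p G K A * x * p G K {w} = 0) ?_ ?_ ?_ hx
    · intro B g hB
      rw [p_mul_ghostWord hA hB]
      exact ghostWord_mul_p_singleton g (hA.inter hB) fun a ha => h a ha.1 a (.inl rfl)
    · intro x y hx hy
      rw [mul_add, add_mul, hx, hy, add_zero]
    · intro k x hx
      rw [mul_smul_comm, smul_mul_assoc, hx, smul_zero]
  induction n generalizing x A with
  | zero => exact h0 x hn A hA h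
  | succ n ih =>
    refine filt_succ_induction (C := fun x => p G K A * x * p G K {w} = 0) ?_ ?_ ?_ hn
    · exact fun x hx => h0 x hx A hA h
    · intro e x hx
      by_cases he : G.source e ∈ A
      · rw [← mul_assoc, p_mul_s hA he, ← s_mul_p_range, mul_assoc, mul_assoc, ← mul_assoc (p G K _),
          ih x (.range e) _ hx, mul_zero]
        intro a ha u hu
        refine h _ he u ?_
        rw [reaches_iff_reflTransGen] at hu ⊢
        exact hu.head ⟨e, rfl, ha⟩
      · rw [← mul_assoc, p_mul_s_of_notMem hA he, zero_mul, zero_mul]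
    · intro x y hx hy
      rw [mul_add, add_mul, hx, hy, add_zero]

end LeavittPathAlgebra

/-- A nonzero vector `p_w m'` is carried by some `r` to a vector on which `p_v` does not vanish, so
`p_v r p_w ≠ 0`. -/
theorem downwardDirected_of_isPrimitiveRing (h : IsPrimitiveRing (G.LeavittPathAlgebra K)) :
    G.DownwardDirected := by
  obtain ⟨M, _, ρ, hρ, hinj⟩ := h
  have hne : ∀ v, ∃ m, ρ (p G K {v}) m ≠ 0 := by
    intro v
    by_contra! h'
    refine p_singleton_ne_zero (G := G) (K := K) v (hinj ?_)
    rw [map_zero]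
    exact AddMonoidHom.ext h'
  intro v w
  obtain ⟨m, hm⟩ := hne v
  obtain ⟨m', hm'⟩ := hne w
  obtain ⟨r, hr⟩ := hρ.exists_apply_eq hm' m
  by_contra! hvw
  have := p_mul_mul_p_singleton (K := K) (w := w) r (.singleton v)
    (by rintro _ rfl u hu; exact hvw u hu)
  refine hm ?_
  rw [← hr]
  change (ρ (p G K {v}) * (ρ r * ρ (p G K {w}))) m' = 0
  rw [← map_mul, ← map_mul, ← mul_assoc, this, map_zero]
  rfl

/-- The periodic sequence of edges along a cycle without exit. -/
structure ExitlessLoop (d : ℕ → E) (N : ℕ) : Prop where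
  pos : 0 < N
  add_period (n : ℕ) : d (n + N) = d n
  range_eq (n : ℕ) : G.range (d n) = {G.source (d (n + 1))}
  eq_of_source {n : ℕ} {e : E} : G.source e = G.source (d n) → e = d n
  modEq_of_source {a b : ℕ} : G.source (d a) = G.source (d b) → a ≡ b [MOD N]

/-- Every vertex in the range of an edge of the cycle emits the next edge and no other, so that
range is a single vertex. -/
theorem exists_exitlessLoop {α : List E} (hα : G.IsCycle α) (h : ¬ G.HasExit α) :
    ∃ d N, G.ExitlessLoop d N := by
  obtain ⟨-, ⟨hne, -⟩, hnodup⟩ := hα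
  have hpos : 0 < α.length := List.length_pos_iff.2 hne
  have hmod : ∀ n, n % α.length < α.length := fun n => Nat.mod_lt _ hpos
  simp only [HasExit, not_or, not_exists, not_and, not_not, List.get_eq_getElem] at h
  obtain ⟨h₁, h₂⟩ := h
  have hedge : ∀ n e, G.source e ∈ G.range (α[n % α.length]'(hmod n)) →
      e = α[(n + 1) % α.length]'(hmod _) := by
    intro n e he
    have := h₁ e ⟨n % α.length, hmod n⟩ he
    simpa using this
  have hrange : ∀ n, G.range (α[n % α.length]'(hmod n)) =
      {G.source (α[(n + 1) % α.length]'(hmod _))} := by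
    intro n
    refine (G.range_nonempty _).subset_singleton_iff.1 fun w hw => ?_
    have hs : ¬ G.IsSink w := fun hs => h₂ w ⟨n % α.length, hmod n⟩ hs hw
    simp only [IsSink, not_forall, not_not] at hs
    obtain ⟨e, rfl⟩ := hs
    rw [hedge n e hw]
    rfl
  refine ⟨fun n => α[n % α.length]'(hmod n), α.length, hpos, fun n => ?_, hrange, ?_, ?_⟩
  · simp
  · intro n e he
    -- The index `n + (α.length - 1)` stands for the predecessor of `n`, whose range is the source
    -- of the edge at `n`.
    have hn : (n + (α.length - 1) + 1) % α.length = n % α.length := by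
      rw [show n + (α.length - 1) + 1 = n + α.length by omega, Nat.add_mod_right]
    have := hrange (n + (α.length - 1))
    simp only [hn] at this
    have h' := hedge (n + (α.length - 1)) e (by rw [this]; exact he)
    simp only [hn] at h'
    exact h'
  · intro a b hab
    have := (List.nodup_iff_injective_get.1 hnodup)
      (a₁ := ⟨a % α.length, by simpa using hmod a⟩) (a₂ := ⟨b % α.length, by simpa using hmod b⟩)
      (by simpa using hab)
    exact congrArg Fin.val this

end Ultragraph

/-! ### The corner at a cycle without exit -/

namespace Ultragraph

variable {V E : Type*} {G : Ultragraph V E} {K : Type*} [Field K]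

open LeavittPathAlgebra

variable (G K) in
/-- The product `s_{d i} ⋯ s_{d (i + a - 1)}` of length `a`. -/
noncomputable def along (d : ℕ → E) : ℕ → ℕ → G.LeavittPathAlgebra K
  | i, 0 => p G K {G.source (d i)}
  | i, a + 1 => s G K (d i) * along d (i + 1) a

variable (G K) in
/-- The product `s_{d (i + a - 1)}^* ⋯ s_{d i}^*` of length `a`. -/
noncomputable def ghostAlong (d : ℕ → E) (i : ℕ) : ℕ → G.LeavittPathAlgebra K
  | 0 => p G K {G.source (d i)}
  | a + 1 => t G K (d (i + a)) * ghostAlong d i a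

namespace ExitlessLoop

variable {d : ℕ → E} {N : ℕ} (hd : G.ExitlessLoop d N)

include hd

theorem s_mul_p (i : ℕ) : s G K (d i) * p G K {G.source (d (i + 1))} = s G K (d i) := by
  rw [← hd.range_eq, s_mul_p_range]

theorem p_mul_t (i : ℕ) : p G K {G.source (d (i + 1))} * t G K (d i) = t G K (d i) := by
  rw [← hd.range_eq, p_range_mul_t]

theorem t_mul_s (i : ℕ) : t G K (d i) * s G K (d i) = p G K {G.source (d (i + 1))} := by
  rw [← hd.range_eq, LeavittPathAlgebra.t_mul_s]

/-- The source of `d i` emits no other edge, so the fourth relation has a single summand. -/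
theorem s_mul_t (i : ℕ) : s G K (d i) * t G K (d i) = p G K {G.source (d i)} := by
  have hset : {e | G.source e = G.source (d i)} = {d i} := by
    ext e
    exact ⟨fun h => hd.eq_of_source h, fun h => congrArg G.source h⟩
  have hfin : {e | G.source e = G.source (d i)}.Finite := hset ▸ Set.finite_singleton _
  rw [p_regular _ hfin ⟨d i, rfl⟩, show hfin.toFinset = {d i} by simp [hset],
    Finset.sum_singleton]

omit hd in
theorem p_mul_along (i a : ℕ) : p G K {G.source (d i)} * along G K d i a = along G K d i a := by
  cases a with
  | zero => exact p_mul_self (.singleton _)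
  | succ a => rw [along, ← mul_assoc, p_source_mul_s]

omit hd in
theorem along_mul_along (i a b : ℕ) :
    along G K d i a * along G K d (i + a) b = along G K d i (a + b) := by
  induction a generalizing i with
  | zero => rw [zero_add]; exact p_mul_along i b
  | succ a ih =>
    rw [along, mul_assoc, show i + (a + 1) = i + 1 + a by omega, ih,
      show a + 1 + b = a + b + 1 by omega, along]

omit hd in
theorem along_mul_p (i a : ℕ) :
    along G K d i a * p G K {G.source (d (i + a))} = along G K d i a :=
  along_mul_along i a 0

theorem p_mul_ghostAlong (i a : ℕ) :
    p G K {G.source (d (i + a))} * ghostAlong G K d i a = ghostAlong G K d i a := by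
  cases a with
  | zero => exact p_mul_self (.singleton _)
  | succ a => rw [ghostAlong, ← mul_assoc, ← add_assoc, hd.p_mul_t]

omit hd in
theorem ghostAlong_mul_p (i a : ℕ) :
    ghostAlong G K d i a * p G K {G.source (d i)} = ghostAlong G K d i a := by
  induction a with
  | zero => exact p_mul_self (.singleton _)
  | succ a ih => rw [ghostAlong, mul_assoc, ih]

theorem ghostAlong_mul_ghostAlong (i a b : ℕ) :
    ghostAlong G K d (i + a) b * ghostAlong G K d i a = ghostAlong G K d i (a + b) := by
  induction b with
  | zero => exact hd.p_mul_ghostAlong i a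
  | succ b ih => rw [ghostAlong, mul_assoc, ih, add_assoc, ← add_assoc a b 1, ghostAlong]

theorem along_succ (i a : ℕ) :
    along G K d i (a + 1) = along G K d i a * s G K (d (i + a)) := by
  rw [← along_mul_along, along, along, hd.s_mul_p]

theorem ghostAlong_mul_along (i a : ℕ) :
    ghostAlong G K d i a * along G K d i a = p G K {G.source (d (i + a))} := by
  induction a with
  | zero => exact p_mul_self (.singleton _)
  | succ a ih =>
    rw [hd.along_succ, ghostAlong, mul_assoc, ← mul_assoc (ghostAlong G K d i a), ih,
      p_source_mul_s, hd.t_mul_s, add_assoc]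

theorem along_mul_ghostAlong (i a : ℕ) :
    along G K d i a * ghostAlong G K d i a = p G K {G.source (d i)} := by
  induction a with
  | zero => exact p_mul_self (.singleton _)
  | succ a ih =>
    rw [hd.along_succ, ghostAlong, mul_assoc, ← mul_assoc (s G K _), hd.s_mul_t,
      hd.p_mul_ghostAlong, ih]

theorem add_mul_period (n q : ℕ) : d (q * N + n) = d n := by
  induction q with
  | zero => simp
  | succ q ih => rw [← ih, ← hd.add_period (q * N + n)]; congr 1; ring

theorem along_period (q i a : ℕ) : along G K d (q * N + i) a = along G K d i a := by
  induction a generalizing i with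
  | zero => rw [along, along, hd.add_mul_period]
  | succ a ih => rw [along, along, hd.add_mul_period, add_assoc, ih]

theorem ghostAlong_period (q i a : ℕ) :
    ghostAlong G K d (q * N + i) a = ghostAlong G K d i a := by
  induction a with
  | zero => rw [ghostAlong, ghostAlong, hd.add_mul_period]
  | succ a ih => rw [ghostAlong, ghostAlong, add_assoc, hd.add_mul_period, ih]

omit hd in
variable (G K d N) in
/-- The powers of the loop and of its adjoint. -/
def powers : Set (G.LeavittPathAlgebra K) :=
  {x | ∃ q, x = along G K d 0 (q * N) ∨ x = ghostAlong G K d 0 (q * N)}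

theorem loop_mul_loop (q r : ℕ) : along G K d 0 (q * N) * along G K d 0 (r * N) =
    along G K d 0 ((q + r) * N) := by
  rw [add_mul, ← along_mul_along, zero_add, ← add_zero (q * N), hd.along_period, add_zero]

theorem ghostLoop_mul_ghostLoop (q r : ℕ) :
    ghostAlong G K d 0 (q * N) * ghostAlong G K d 0 (r * N) =
      ghostAlong G K d 0 ((q + r) * N) := by
  rw [add_comm q, add_mul, ← hd.ghostAlong_mul_ghostAlong, zero_add, ← add_zero (r * N),
    hd.ghostAlong_period, add_zero]

theorem ghostLoop_mul_loop (q : ℕ) :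
    ghostAlong G K d 0 (q * N) * along G K d 0 (q * N) = p G K {G.source (d 0)} := by
  rw [hd.ghostAlong_mul_along, zero_add, ← add_zero (q * N), hd.add_mul_period]

theorem loop_mul_p (q : ℕ) :
    along G K d 0 (q * N) * p G K {G.source (d 0)} = along G K d 0 (q * N) := by
  have := along_mul_p (G := G) (K := K) (d := d) 0 (q * N)
  rwa [zero_add, ← add_zero (q * N), hd.add_mul_period, add_zero] at this

theorem p_mul_ghostLoop (q : ℕ) :
    p G K {G.source (d 0)} * ghostAlong G K d 0 (q * N) = ghostAlong G K d 0 (q * N) := by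
  have := hd.p_mul_ghostAlong (K := K) 0 (q * N)
  rwa [zero_add, ← add_zero (q * N), hd.add_mul_period, add_zero] at this

/-- The loop and its adjoint are inverse to each other in the corner; both products reduce to the
power given by the difference of the exponents. -/
theorem loop_mul_ghostLoop_comm (q r : ℕ) :
    along G K d 0 (q * N) * ghostAlong G K d 0 (r * N) =
      ghostAlong G K d 0 (r * N) * along G K d 0 (q * N) := by
  obtain h | h := le_total q r
  · obtain ⟨k, rfl⟩ := Nat.exists_eq_add_of_le h
    rw [← hd.ghostLoop_mul_ghostLoop, ← mul_assoc, hd.along_mul_ghostAlong,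
      hd.p_mul_ghostLoop, hd.ghostLoop_mul_ghostLoop, add_comm, ← hd.ghostLoop_mul_ghostLoop,
      mul_assoc, hd.ghostLoop_mul_loop, ghostAlong_mul_p]
  · obtain ⟨k, rfl⟩ := Nat.exists_eq_add_of_le h
    rw [← hd.loop_mul_loop, ← mul_assoc (ghostAlong G K d 0 _), hd.ghostLoop_mul_loop,
      p_mul_along, hd.loop_mul_loop, add_comm, ← hd.loop_mul_loop, mul_assoc,
      hd.along_mul_ghostAlong, hd.loop_mul_p]

theorem powers_comm {x y : G.LeavittPathAlgebra K} (hx : x ∈ powers G K d N)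
    (hy : y ∈ powers G K d N) : x * y = y * x := by
  obtain ⟨q, rfl | rfl⟩ := hx <;> obtain ⟨r, rfl | rfl⟩ := hy
  · rw [hd.loop_mul_loop, hd.loop_mul_loop, add_comm]
  · exact hd.loop_mul_ghostLoop_comm q r
  · exact (hd.loop_mul_ghostLoop_comm r q).symm
  · rw [hd.ghostLoop_mul_ghostLoop, hd.ghostLoop_mul_ghostLoop, add_comm]

theorem span_powers_comm {x y : G.LeavittPathAlgebra K}
    (hx : x ∈ Submodule.span K (powers G K d N)) (hy : y ∈ Submodule.span K (powers G K d N)) :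
    x * y = y * x := by
  induction hx, hy using Submodule.span_induction₂ with
  | mem_mem x y hx hy => exact hd.powers_comm hx hy
  | zero_left y _ => rw [zero_mul, mul_zero]
  | zero_right x _ => rw [zero_mul, mul_zero]
  | add_left x y z _ _ _ h₁ h₂ => rw [add_mul, mul_add, h₁, h₂]
  | add_right x y z _ _ _ h₁ h₂ => rw [add_mul, mul_add, h₁, h₂]
  | smul_left k x y _ _ h => rw [smul_mul_assoc, mul_smul_comm, h]
  | smul_right k x y _ _ h => rw [smul_mul_assoc, mul_smul_comm, h]

/-- The product vanishes unless both parts end at the same vertex. Then the lengths agree modulo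
`N`, the shorter part cancels, and whole turns remain. -/
theorem along_mul_ghostAlong_mem (a b : ℕ) :
    along G K d 0 a * ghostAlong G K d 0 b ∈ Submodule.span K (powers G K d N) := by
  by_cases hab : G.source (d a) = G.source (d b)
  · obtain h | h := le_total a b
    · obtain ⟨q, hq⟩ := (Nat.modEq_iff_dvd' h).1 (hd.modEq_of_source hab)
      obtain rfl : b = q * N + a := by rw [mul_comm]; omega
      rw [← hd.ghostAlong_mul_ghostAlong, zero_add, ← add_zero (q * N), hd.ghostAlong_period,
        ← mul_assoc, hd.along_mul_ghostAlong, add_zero, hd.p_mul_ghostLoop]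
      exact Submodule.subset_span ⟨q, .inr rfl⟩
    · obtain ⟨q, hq⟩ := (Nat.modEq_iff_dvd' h).1 (hd.modEq_of_source hab.symm)
      obtain rfl : a = q * N + b := by rw [mul_comm]; omega
      rw [← along_mul_along, zero_add, ← add_zero (q * N), hd.along_period, mul_assoc,
        hd.along_mul_ghostAlong, add_zero, hd.loop_mul_p]
      exact Submodule.subset_span ⟨q, .inl rfl⟩
  · rw [← along_mul_p, ← hd.p_mul_ghostAlong, mul_assoc, ← mul_assoc (p G K _), zero_add,
      zero_add, p_mul_p_singleton_of_notMem (.singleton _) (by simpa using Ne.symm hab),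
      zero_mul, mul_zero]
    exact Submodule.zero_mem _

/-- Read from the right, the ghost edges start at the loop and cannot leave it, since each of its
vertices emits only one edge. -/
theorem ghostWord_mul_p (g : List E) {A : Set V} (hA : G.IsGenVertex A) :
    ghostWord G K A g * p G K {G.source (d 0)} = 0 ∨
      ∃ b, ghostWord G K A g * p G K {G.source (d 0)} = p G K A * ghostAlong G K d 0 b := by
  induction g generalizing A with
  | nil => exact .inr ⟨0, rfl⟩
  | cons e g ih =>
    rw [ghostWord, mul_assoc, mul_assoc]
    obtain h | ⟨b, h⟩ := ih (.singleton (G.source e))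
    · exact .inl (by rw [h, mul_zero, mul_zero])
    · rw [h]
      by_cases he : G.source e = G.source (d b)
      · obtain rfl := hd.eq_of_source he
        refine .inr ⟨b + 1, ?_⟩
        rw [← mul_assoc (t G K _), t_mul_p_source, ghostAlong, zero_add]
      · refine .inl ?_
        rw [← hd.p_mul_ghostAlong, ← mul_assoc (p G K {G.source e}), zero_add,
          p_mul_p_singleton_of_notMem (.singleton _) (by simpa using Ne.symm he), zero_mul,
          mul_zero, mul_zero]

/-- The leading edge of a nonzero term must be `d i`; removing it moves the left end to `i + 1`, so
`i` varies while the right end stays at `d 0`. -/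
theorem p_mul_mul_p_mem (n : ℕ) (i : ℕ) {x : G.LeavittPathAlgebra K} (hx : x ∈ filt G K n) :
    p G K {G.source (d i)} * x * p G K {G.source (d 0)} ∈
      Submodule.span K {y | ∃ a b, y = along G K d i a * ghostAlong G K d 0 b} := by
  have h0 : ∀ i, ∀ x ∈ ghostSpan G K, p G K {G.source (d i)} * x * p G K {G.source (d 0)} ∈
      Submodule.span K {y | ∃ a b, y = along G K d i a * ghostAlong G K d 0 b} := by
    intro i x hx
    refine ghostSpan_induction (C := fun x => p G K {G.source (d i)} * x *
      p G K {G.source (d 0)} ∈ Submodule.span K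
        {y | ∃ a b, y = along G K d i a * ghostAlong G K d 0 b}) ?_ ?_ ?_ hx
    · intro A g hA
      rw [mul_assoc]
      obtain h | ⟨b, h⟩ := hd.ghostWord_mul_p (K := K) g hA
      · rw [h, mul_zero]
        exact Submodule.zero_mem _
      · rw [h, ← mul_assoc]
        by_cases hi : G.source (d i) ∈ A
        · rw [p_singleton_mul_p hA hi]
          exact Submodule.subset_span ⟨0, b, rfl⟩
        · rw [p_singleton_mul_p_of_notMem hA hi, zero_mul]
          exact Submodule.zero_mem _
    · intro x y hx hy
      rw [mul_add, add_mul]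
      exact Submodule.add_mem _ hx hy
    · intro k x hx
      rw [mul_smul_comm, smul_mul_assoc]
      exact Submodule.smul_mem _ k hx
  induction n generalizing i x with
  | zero => exact h0 i x hx
  | succ n ih =>
    refine filt_succ_induction (C := fun x => p G K {G.source (d i)} * x *
      p G K {G.source (d 0)} ∈ Submodule.span K
        {y | ∃ a b, y = along G K d i a * ghostAlong G K d 0 b}) (h0 i) ?_ ?_ hx
    · intro e x hx
      by_cases he : G.source e = G.source (d i)
      · obtain rfl := hd.eq_of_source he
        rw [← mul_assoc, p_source_mul_s, ← hd.s_mul_p, mul_assoc, mul_assoc, ← mul_assoc (p G K _)]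
        refine Submodule.span_induction (p := fun y _ => s G K (d i) * y ∈ Submodule.span K
          {y | ∃ a b, y = along G K d i a * ghostAlong G K d 0 b}) ?_ ?_ ?_ ?_ (ih (i + 1) hx)
        · rintro _ ⟨a, b, rfl⟩
          exact Submodule.subset_span ⟨a + 1, b, by rw [along, mul_assoc]⟩
        · rw [mul_zero]
          exact Submodule.zero_mem _
        · intro x y _ _ hx hy
          rw [mul_add]
          exact Submodule.add_mem _ hx hy
        · intro k x _ hx
          rw [mul_smul_comm]
          exact Submodule.smul_mem _ k hx
      · rw [← mul_assoc, p_mul_s_of_notMem (.singleton _) (by simpa), zero_mul, zero_mul]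
        exact Submodule.zero_mem _
    · intro x y hx hy
      rw [mul_add, add_mul]
      exact Submodule.add_mem _ hx hy

theorem p_mul_mul_p_mem_span_powers (x : G.LeavittPathAlgebra K) :
    p G K {G.source (d 0)} * x * p G K {G.source (d 0)} ∈
      Submodule.span K (powers G K d N) := by
  obtain ⟨n, hn⟩ := exists_mem_filt x
  refine Submodule.span_le.2 ?_ (hd.p_mul_mul_p_mem n 0 hn)
  rintro _ ⟨a, b, rfl⟩
  exact hd.along_mul_ghostAlong_mem a b

/-- The corner at a vertex on a cycle without exit is commutative. -/
theorem corner_comm (x y : G.LeavittPathAlgebra K) :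
    (p G K {G.source (d 0)} * x * p G K {G.source (d 0)}) *
        (p G K {G.source (d 0)} * y * p G K {G.source (d 0)}) =
      (p G K {G.source (d 0)} * y * p G K {G.source (d 0)}) *
        (p G K {G.source (d 0)} * x * p G K {G.source (d 0)}) :=
  hd.span_powers_comm (hd.p_mul_mul_p_mem_span_powers x) (hd.p_mul_mul_p_mem_span_powers y)

/-- The boundary path that runs along the loop. -/
def path (i : ℕ) : G.BoundaryPath where
  seq n := .inr (d (i + n))
  valid n := by
    refine ⟨fun w hw => (nomatch hw), fun e he => ?_⟩
    obtain rfl := Sum.inr_injective he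
    rw [hd.range_eq]
    rfl

theorem rep_along_apply (a i : ℕ) (m : G.BoundaryPath × ℤ →₀ K) (k : ℤ) :
    (BoundaryPath.system G).graded.rep K (along G K d i a) m (hd.path i, k) =
      m (hd.path (i + a), k - a) := by
  induction a generalizing i k with
  | zero =>
    rw [along, BranchingSystem.rep_p_apply _ (.singleton _), if_pos]
    · simp
    · exact rfl
  | succ a ih =>
    rw [along, map_mul, Module.End.mul_apply, BranchingSystem.rep_s_apply, if_pos]
    · have : (BoundaryPath.system G).graded.tail (hd.path i, k) = (hd.path (i + 1), k - 1) := by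
        refine Prod.ext (BoundaryPath.ext (funext fun n => ?_)) rfl
        exact congrArg (fun j => Sum.inr (d j)) (by omega)
      rw [this, ih]
      congr 2
      · congr 1
        omega
      · push_cast
        ring
    · exact rfl

theorem path_period : hd.path N = hd.path 0 := by
  refine BoundaryPath.ext (funext fun n => ?_)
  have := hd.add_period n
  change Sum.inr (d (N + n)) = Sum.inr (d (0 + n))
  rw [zero_add, add_comm N, this]

/-- On the copies of the periodic path the element acts as a difference operator with step `N`.
Without the degree the loop would fix this path and the difference would be zero. -/
theorem rep_loop_apply (m : G.BoundaryPath × ℤ →₀ K) (k : ℤ) :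
    (BoundaryPath.system G).graded.rep K (p G K {G.source (d 0)} - along G K d 0 N) m
      (hd.path 0, k) = m (hd.path 0, k) - m (hd.path 0, k - N) := by
  have h0 := hd.rep_along_apply 0 0 m k
  rw [map_sub, LinearMap.sub_apply, Finsupp.sub_apply, hd.rep_along_apply, zero_add,
    hd.path_period]
  congr 1
  rw [along] at h0
  rw [h0]
  simp

theorem loop_ne : p G K {G.source (d 0)} - along G K d 0 N ≠ 0 := by
  classical
  intro h
  have := hd.rep_loop_apply (K := K) (Finsupp.single (hd.path 0, 0) 1) 0
  have hN := hd.pos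
  rw [h, map_zero, Finsupp.single_eq_same, Finsupp.single_eq_of_ne] at this
  · simp at this
  · intro h'
    have := congrArg Prod.snd h'
    simp only at this
    omega

/-- Otherwise a finitely supported function of the degree would have a unit impulse at `0` as its
difference with step `N`. It would be constant on the multiples of `N` from `0` upwards and on the
negative ones, hence zero on both, and there would be no jump at `0`. -/
theorem loop_mul_ne (x : G.LeavittPathAlgebra K) :
    (p G K {G.source (d 0)} - along G K d 0 N) * x ≠ p G K {G.source (d 0)} := by
  classical
  intro h
  let B := (BoundaryPath.system G).graded
  let v : G.BoundaryPath × ℤ →₀ K := Finsupp.single (hd.path 0, 0) 1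
  let m := B.rep K x v
  have hN := hd.pos
  have hm : ∀ k : ℤ, v (hd.path 0, k) = m (hd.path 0, k) - m (hd.path 0, k - N) := by
    intro k
    rw [← hd.rep_loop_apply m k]
    change _ = (B.rep K _ * B.rep K x) v _
    rw [← map_mul, h]
    have := hd.rep_along_apply 0 0 v k
    rw [along] at this
    rw [this]
    simp
  have hv0 : v (hd.path 0, 0) = 1 := Finsupp.single_eq_same
  have hvk : ∀ k : ℤ, k ≠ 0 → v (hd.path 0, k) = 0 := fun k hk =>
    Finsupp.single_eq_of_ne fun h' => hk (congrArg Prod.snd h')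
  have hup : ∀ n : ℕ, m (hd.path 0, (n * N : ℕ)) = m (hd.path 0, 0) := by
    intro n
    induction n with
    | zero => simp
    | succ n ih =>
      have h₁ := hm (((n + 1) * N : ℕ) : ℤ)
      rw [hvk _ (by positivity)] at h₁
      rw [sub_eq_zero.1 h₁.symm, ← ih]
      congr 2
      push_cast
      ring
  have hdown : ∀ n : ℕ, m (hd.path 0, -(((n + 1) * N : ℕ) : ℤ)) = m (hd.path 0, 0 - N) := by
    intro n
    induction n with
    | zero => simp
    | succ n ih =>
      have h₁ := hm (-(((n + 1) * N : ℕ) : ℤ))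
      rw [hvk _ (by have : 0 < (n + 1) * N := by positivity
                    omega)] at h₁
      rw [← ih, sub_eq_zero.1 h₁.symm]
      congr 2
      push_cast
      ring
  have hinf : ∀ f : ℕ → ℤ, Function.Injective f → ∃ n, m (hd.path 0, f n) = 0 := by
    intro f hf
    have hinj : Function.Injective fun n => (hd.path 0, f n) := fun a b hab =>
      hf (congrArg Prod.snd hab)
    obtain ⟨_, ⟨n, rfl⟩, hn⟩ := (Set.infinite_range_of_injective hinj).exists_notMem_finset
      m.support
    exact ⟨n, Finsupp.notMem_support_iff.1 hn⟩
  obtain ⟨n, hn⟩ := hinf (fun n => ((n * N : ℕ) : ℤ)) fun a b hab =>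
    Nat.eq_of_mul_eq_mul_right hN (Nat.cast_injective hab)
  obtain ⟨n', hn'⟩ := hinf (fun n => -(((n + 1) * N : ℕ) : ℤ)) fun a b hab =>
    Nat.succ_injective (Nat.eq_of_mul_eq_mul_right hN (Nat.cast_injective (neg_injective hab)))
  rw [hup] at hn
  rw [hdown] at hn'
  have := hm 0
  rw [hv0, hn, hn', sub_zero] at this
  exact one_ne_zero this

end ExitlessLoop

/-- Schur's lemma in a commutative corner: a faithful simple module makes every nonzero element of
`q L q` invertible there, but `f` is nonzero and not invertible. -/
theorem hasExit_of_isPrimitiveRing (h : IsPrimitiveRing (G.LeavittPathAlgebra K)) {α : List E}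
    (hα : G.IsCycle α) : G.HasExit α := by
  by_contra hex
  obtain ⟨d, N, hd⟩ := exists_exitlessLoop hα hex
  obtain ⟨M, _, ρ, hρ, hinj⟩ := h
  set q := p G K {G.source (d 0)} with hq
  set f := q - along G K d 0 N with hf
  have hqq : q * q = q := p_mul_self (.singleton _)
  have hqf : q * f = f := by
    rw [hf, mul_sub, hqq, hq, ExitlessLoop.p_mul_along]
  have hfq : f * q = f := by
    have := hd.loop_mul_p (K := K) 1
    rw [one_mul] at this
    rw [hf, sub_mul, hqq, hq, this]
  have hmul : ∀ x y m, ρ (x * y) m = ρ x (ρ y m) := fun x y m => by rw [map_mul]; rfl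
  -- The vector `m` generates the module. By commutativity an element of the corner that kills `m`
  -- also kills every `q r q m`, hence the whole module, and it is zero by faithfulness.
  have key : ∀ x m, m ≠ 0 → ρ q m = m → ρ (q * x * q) m = 0 → q * x * q = 0 := by
    intro x m hm hqm hxm
    refine hinj (AddMonoidHom.ext fun m' => ?_)
    rw [map_zero]
    obtain ⟨r, rfl⟩ := hρ.exists_apply_eq hm m'
    have hrm : ρ (q * r * q) m = ρ q (ρ r m) := by rw [hmul, hqm, hmul]
    have h₁ : ρ (q * x * q) (ρ r m) = ρ ((q * x * q) * (q * r * q)) m := by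
      rw [hmul (q * x * q), hrm, ← hmul _ q, mul_assoc _ q q, hqq]
    change ρ (q * x * q) (ρ r m) = 0
    rw [h₁, hd.corner_comm, hmul, hxm, map_zero]
  obtain ⟨m₀, hm₀⟩ : ∃ m, ρ q m ≠ 0 := by
    by_contra! h'
    refine p_singleton_ne_zero (G := G) (K := K) (G.source (d 0)) (hinj ?_)
    rw [map_zero]
    exact AddMonoidHom.ext h'
  have hqm : ρ q (ρ q m₀) = ρ q m₀ := by rw [← hmul, hqq]
  have hfm : ρ f (ρ q m₀) ≠ 0 := by
    intro h'
    have h₁ : q * f * q = f := by rw [hqf, hfq]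
    have := key f _ hm₀ hqm (by rw [h₁, h'])
    rw [h₁] at this
    exact hd.loop_ne this
  obtain ⟨r, hr⟩ := hρ.exists_apply_eq hfm (ρ q m₀)
  -- Since `r f` fixes `q m₀`, this element of the corner kills `q m₀`; so `q r q` is a left inverse
  -- of `f`, and by commutativity a right inverse.
  have h₁ : q * (r * f - q) * q = 0 := by
    refine key _ _ hm₀ hqm ?_
    rw [hmul, hqm, hmul, map_sub]
    have : (ρ (r * f) - ρ q) (ρ q m₀) = 0 := by
      change ρ (r * f) (ρ q m₀) - ρ q (ρ q m₀) = 0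
      rw [hmul, hr, hqm, sub_self]
    rw [this, map_zero]
  have h₂ : (q * r * q) * (q * f * q) = q := by
    rw [mul_sub, sub_mul, hqq, hqq, sub_eq_zero] at h₁
    refine Eq.trans ?_ h₁
    rw [hqf, hfq, mul_assoc (q * r), hqf, mul_assoc q r f, mul_assoc q (r * f) q, mul_assoc r,
      hfq]
  rw [hd.corner_comm, hqf, hfq] at h₂
  exact hd.loop_mul_ne _ h₂

end Ultragraph

theorem mainTheorem8 {V E K : Type*} [Countable V] [Countable E] [Nonempty V] [Field K]
    (G : Ultragraph V E) :
    IsPrimitiveRing (G.LeavittPathAlgebra K) ↔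
      G.DownwardDirected ∧ ∀ α : List E, G.IsCycle α → G.HasExit α := by
  refine ⟨fun h => ⟨?_, fun α hα => ?_⟩, fun h => ?_⟩
  · exact Ultragraph.downwardDirected_of_isPrimitiveRing h
  · exact Ultragraph.hasExit_of_isPrimitiveRing h hα
  · exact Ultragraph.isPrimitiveRing_of_downwardDirected h.1 h.2
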